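/- Let $\mathbf k$ be a field of characteristic zero and $H$ a cocommutative Hopf algebra over $\mathbf k$; write $\otimes=\otimes_{\mathbf k}$. For a left $H$-module $M$ let $H^{\otimes n}\otimes_H M$ be formed with the right action of $H$ on $H^{\otimes n}$ through the iterated coproduct; a permutation $\sigma\in S_n$ acts on it by $\sigma\otimes_H\mathrm{id}$, where $\sigma$ moves the $i$-th tensor factor to position $\sigma(i)$. For left $H$-modules $A,M$ let $C^n(A,M)$ be the space of $H^{\otimes n}$-linear maps $f:A^{\otimes n}\to H^{\otimes n}\otimes_H M$ which are skew-symmetric, $f(x_1,\dots,x_n)=(-1)^\sigma(\sigma\otimes_H\mathrm{id})f(x_{\sigma(1)},\dots,x_{\sigma(n)})$. On $\bigoplus_{n\ge 0}C^{n+1}(A,A)$ the Nijenhuis--Richardson bracket of $f\in C^p(A,A)$ and $g\in C^q(A,A)$ is $[f,g]_{NR}=f\circledcirc g-(-1)^{(p-1)(q-1)}g\circledcirc f\in C^{p+q-1}(A,A)$, where $$(f\circledcirc g)(x_1,\dots,x_{p+q-1})=\sum_{\sigma}(-1)^\sigma(\sigma\otimes_H\mathrm{id})f\big(g(x_{\sigma(1)},\dots,x_{\sigma(q)}),x_{\sigma(q+1)},\dots,x_{\sigma(p+q-1)}\big),$$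 the sum is over the $(q,p-1)$-shuffles, and $f$ is extended to arguments in $H^{\otimes q}\otimes_H A$ by $H$-polylinearity. Let $(\mathfrak G,\mathfrak g,\mathfrak h)$ be a quasi-twilled Lie $H$-pseudoalgebra: $\mathfrak G=\mathfrak g\boxplus\mathfrak h$ is a direct sum of left $H$-modules with a Lie pseudobracket $\Omega\in C^2(\mathfrak G,\mathfrak G)$ (skew-symmetric, $H^{\otimes 2}$-linear, satisfying the Jacobi identity), and $\mathfrak h$ is a subpseudoalgebra. Write, for $x,y\in\mathfrak g$ and $u,v\in\mathfrak h$, $$\Omega(x,y)=\big(\pi(x\otimes y),\theta(x\otimes y)\big),\qquad \Omega(x,u)=\big(\eta(x\otimes u),\rho(x\otimes u)\big),\qquad \Omega(u,v)=\big(0,\mu(u\otimes v)\big),$$ and regard $\pi,\rho,\mu,\eta,\theta$ also as elements of $C^2(\mathfrak G,\mathfrak G)$ by extending them by zero and skew-symmetrically, so that $\Omega=\pi+\rho+\mu+\eta+\theta$. A deformation map of type I is an $H$-module homomorphism $D:\mathfrak g\to\mathfrak h$ such that for all $x,y\in\mathfrak g$ $$(\mathrm{id}\otimes_H D)\big(\pi(x\otimes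 y)+\eta(x\otimes D(y))-((12)\otimes_H\mathrm{id})\eta(y\otimes D(x))\big)=\mu(D(x)\otimes D(y))+\rho(x\otimes D(y))-((12)\otimes_H\mathrm{id})\rho(y\otimes D(x))+\theta(x\otimes y).$$ On $\bigoplus_{n\ge0}C^{n+1}(\mathfrak g,\mathfrak h)$, regarded as a subspace of $\bigoplus_{n\ge0}C^{n+1}(\mathfrak G,\mathfrak G)$ by extension by zero, put $$l_1(f)=[\pi+\rho,f]_{NR},\qquad l_2(f,f')=[[\mu+\eta,f]_{NR},f']_{NR},$$ and identify an $H$-linear map $D:\mathfrak g\to\mathfrak h$ with the element $x\mapsto 1\otimes_H D(x)$ of $C^1(\mathfrak g,\mathfrak h)$. For a deformation map $D$ of type I, the twisted operations are $$l_1^D(f)=l_1(f)+l_2(D,f),\qquad l_2^D(f,f')=l_2(f,f').$$ **Theorem.** Let $D$ be a deformation map of type I of $(\mathfrak G,\mathfrak g,\mathfrak h)$. Then for every homomorphism of left $H$-modules $D':\mathfrak g\to\mathfrak h$, the sum $D+D'$ is a deformation map of type I if and only if $D'$ is a Maurer--Cartan element of the twisted $\mathfrak L_\infty$-pseudoalgebra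 $\big(\bigoplus_{n\ge0}C^{n+1}(\mathfrak g,\mathfrak h),l_1^D,l_2^D\big)$, i.e. $$l_1^D(D')+\tfrac12\,l_2^D(D',D')=0 .$$ -/

import Mathlib

open scoped TensorProduct
namespace Pseudo
section Tensors
variable (k H : Type*) [Field k] [Ring H] [HopfAlgebra k H]

/-- The tensor power `H^{⊗ n}`, with its componentwise algebra structure. -/
abbrev Tens (n : ℕ) : Type _ := ⨂[k] _ : Fin n, H

variable {k H}

theorem extend_update {m n : ℕ} (e : Fin m ↪ Fin n) (h : Fin m → H) (i : Fin m) (x : H) :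
    Function.extend e (Function.update h i x) (1 : Fin n → H) =
      Function.update (Function.extend e h 1) (e i) x := by
  funext j
  by_cases hj : ∃ i', e i' = j
  · obtain ⟨i', rfl⟩ := hj
    rw [e.injective.extend_apply]
    by_cases hi : i' = i
    · subst hi; simp
    · rw [Function.update_of_ne hi, Function.update_of_ne (fun hh => hi (e.injective hh)),
        e.injective.extend_apply]
  · rw [Function.extend_apply' _ _ _ hj, Function.update_of_ne (fun hh => hj ⟨i, hh.symm⟩),
      Function.extend_apply' _ _ _ hj]

variable (k) in
/-- The algebra map `H^{⊗ m} → H^{⊗ n}` which puts the `i`-th tensor factor in position `e i`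
and `1` in the positions not of this form. -/
noncomputable def emb {m n : ℕ} (e : Fin m ↪ Fin n) : Tens k H m →ₐ[k] Tens k H n :=
  PiTensorProduct.liftAlgHom
    { toFun := fun h => PiTensorProduct.tprod k (Function.extend e h (1 : Fin n → H))
      map_update_add' := by
        intro inst h i x y
        cases Subsingleton.elim inst (instDecidableEqFin m)
        simp only [extend_update, MultilinearMap.map_update_add]
      map_update_smul' := by
        intro inst h i c x
        cases Subsingleton.elim inst (instDecidableEqFin m)
        simp only [extend_update, MultilinearMap.map_update_smul] }
    (by
      change PiTensorProduct.tprod k (Function.extend e (1 : Fin m → H) (1 : Fin n → H)) = 1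
      rw [Function.extend_one]; rfl)
    (by
      intro h h'
      change PiTensorProduct.tprod k (Function.extend e (h * h') (1 : Fin n → H)) =
        PiTensorProduct.tprod k _ * PiTensorProduct.tprod k _
      rw [PiTensorProduct.tprod_mul_tprod, ← Function.extend_mul, one_mul])

theorem emb_tprod {m n : ℕ} (e : Fin m ↪ Fin n) (h : Fin m → H) :
    emb k e (PiTensorProduct.tprod k h) =
      PiTensorProduct.tprod k (Function.extend e h (1 : Fin n → H)) := by
  simp [emb, PiTensorProduct.liftAlgHom]

variable (k H) in
/-- The algebra map `H → H^{⊗ n}` which puts an element in position `i` and `1` elsewhere. -/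
noncomputable def slot {n : ℕ} (i : Fin n) : H →ₐ[k] Tens k H n :=
  PiTensorProduct.singleAlgHom (A := fun _ : Fin n => H) i

theorem slot_apply {n : ℕ} (i : Fin n) (x : H) :
    slot k H i x = PiTensorProduct.tprod k (Function.update (1 : Fin n → H) i x) := rfl

theorem emb_slot {m n : ℕ} (e : Fin m ↪ Fin n) (i : Fin m) (x : H) :
    emb k e (slot k H i x) = slot k H (e i) x := by
  rw [slot_apply, slot_apply, emb_tprod, extend_update, Function.extend_one]

theorem emb_emb {l m n : ℕ} (e : Fin l ↪ Fin m) (e' : Fin m ↪ Fin n) (t : Tens k H l) :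
    emb k e' (emb k e t) = emb k (e.trans e') t := by
  have : (emb k e').comp (emb k e) = emb k (H := H) (e.trans e') := by
    refine PiTensorProduct.algHom_ext fun i => AlgHom.ext fun x => ?_
    change emb k e' (emb k e (slot k H i x)) = emb k (e.trans e') (slot k H i x)
    rw [emb_slot, emb_slot, emb_slot]
    rfl
  exact DFunLike.congr_fun this t

theorem commute_tprod_extend {m p n : ℕ} (e : Fin m ↪ Fin n) (e' : Fin p ↪ Fin n)
    (he : ∀ i j, e i ≠ e' j) (a : Tens k H m) (b : Tens k H p) :
    Commute (emb k e a) (emb k e' b) := by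
  induction a using PiTensorProduct.induction_on with
  | add x y hx hy => rw [map_add]; exact hx.add_left hy
  | smul_tprod r h =>
    rw [map_smul]
    refine Commute.smul_left ?_ r
    induction b using PiTensorProduct.induction_on with
    | add x y hx hy => rw [map_add]; exact hx.add_right hy
    | smul_tprod r' h' =>
      rw [map_smul]
      refine Commute.smul_right ?_ r'
      rw [emb_tprod, emb_tprod]
      refine Commute.tprod ?_
      funext j
      simp only [Pi.mul_apply]
      by_cases hj : ∃ i, e i = j
      · obtain ⟨i, rfl⟩ := hj
        rw [Function.extend_apply' (f := e') _ _ _ (fun ⟨l, hl⟩ => he i l hl.symm)]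
        simp
      · rw [Function.extend_apply' (f := e) _ _ _ hj]
        simp

theorem commute_slot {n : ℕ} {i j : Fin n} (hij : i ≠ j) (x y : H) :
    Commute (slot k H i x) (slot k H j y) := by
  refine Commute.tprod ?_
  funext l
  simp only [Pi.mul_apply, MonoidHom.mulSingle_apply]
  by_cases hi : l = i
  · subst hi; simp [Pi.mulSingle_eq_of_ne hij]
  · simp [Pi.mulSingle_eq_of_ne hi]

theorem commute_slot_emb_succ {n : ℕ} (x : H) (b : Tens k H n) :
    Commute (slot k H (0 : Fin (n + 1)) x) (emb k (Fin.succEmb n) b) := by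
  have h := commute_tprod_extend (k := k) (H := H) (n := n + 1)
    (⟨fun _ : Fin 1 => (0 : Fin (n + 1)), fun _ _ _ => Subsingleton.elim _ _⟩) (Fin.succEmb n)
    (fun i j => (Fin.succ_ne_zero j).symm) (slot k H 0 x) b
  rwa [emb_slot] at h

variable (k H) in
/-- The iterated coproduct `H → H^{⊗ n}`, `h ↦ h₍₁₎ ⊗ ⋯ ⊗ h₍ₙ₎`: for `n = 0` it is the counit, and
the `(n + 1)`-fold one sends `h` to `h₍₁₎ ⊗ diag n (h₍₂₎)`. -/
noncomputable def diag : (n : ℕ) → (H →ₐ[k] Tens k H n)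
  | 0 => (Algebra.ofId k (Tens k H 0)).comp (Bialgebra.counitAlgHom k H)
  | n + 1 => (Algebra.TensorProduct.lift (slot k H (0 : Fin (n + 1)))
      ((emb k (Fin.succEmb n)).comp (diag n))
      (fun x y => commute_slot_emb_succ x (diag n y))).comp (Bialgebra.comulAlgHom k H)

/-- An algebra map out of `H`, as an element of the convolution algebra. -/
noncomputable def conv {A : Type*} [Ring A] [Algebra k A] (f : H →ₐ[k] A) :
    WithConv (H →ₗ[k] A) := WithConv.toConv f.toLinearMap

/-- Postcomposition with an algebra map is multiplicative for convolution. -/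
noncomputable def convMap {A B : Type*} [Ring A] [Algebra k A] [Ring B] [Algebra k B]
    (φ : A →ₐ[k] B) : WithConv (H →ₗ[k] A) →* WithConv (H →ₗ[k] B) where
  toFun f := WithConv.toConv (φ.toLinearMap.comp f.ofConv)
  map_one' := by ext x; simp
  map_mul' f g := by rw [LinearMap.algHom_comp_convMul_distrib]

theorem convMap_conv {A B : Type*} [Ring A] [Algebra k A] [Ring B] [Algebra k B]
    (φ : A →ₐ[k] B) (f : H →ₐ[k] A) : convMap φ (conv f) = conv (φ.comp f) := rfl

theorem conv_injective {A : Type*} [Ring A] [Algebra k A] {f g : H →ₐ[k] A}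
    (h : conv f = conv g) : f = g :=
  AlgHom.toLinearMap_injective (WithConv.toConv_injective h)

theorem conv_commute [Coalgebra.IsCocomm k H] {A : Type*} [Ring A] [Algebra k A]
    (f g : H →ₐ[k] A) (hfg : ∀ x y, Commute (f x) (g y)) : Commute (conv f) (conv g) := by
  ext x
  have key : ∀ t : H ⊗[k] H, LinearMap.mul' k A (TensorProduct.map f.toLinearMap g.toLinearMap t) =
      LinearMap.mul' k A (TensorProduct.map g.toLinearMap f.toLinearMap
        (TensorProduct.comm k H H t)) := by
    intro t
    induction t with
    | zero => simp
    | add x y hx hy => simp only [map_add, hx, hy]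
    | tmul a b => simpa using (hfg a b).eq
  change LinearMap.mul' k A (TensorProduct.map f.toLinearMap g.toLinearMap (Coalgebra.comul x)) =
    LinearMap.mul' k A (TensorProduct.map g.toLinearMap f.toLinearMap (Coalgebra.comul x))
  rw [key, Coalgebra.comm_comul]

theorem conv_diag (n : ℕ) :
    conv (diag k H n) = (List.ofFn fun i : Fin n => conv (slot k H i)).prod := by
  induction n with
  | zero => ext x; simp [conv, diag, Algebra.ofId_apply]
  | succ n ih =>
    have h1 : conv (diag k H (n + 1)) =
        conv (slot k H 0) * conv ((emb k (Fin.succEmb n)).comp (diag k H n)) := by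
      ext x
      change Algebra.TensorProduct.lift (slot k H (0 : Fin (n + 1)))
        ((emb k (Fin.succEmb n)).comp (diag k H n))
        (fun x y => commute_slot_emb_succ x (diag k H n y)) (Coalgebra.comul x) = LinearMap.mul' k _
        (TensorProduct.map _ _ (Coalgebra.comul x))
      generalize (Coalgebra.comul x : H ⊗[k] H) = t
      induction t with
      | zero => simp
      | add x y hx hy => simp only [map_add, hx, hy]
      | tmul a b => exact Algebra.TensorProduct.lift_tmul _ _ _ a b
    rw [h1, ← convMap_conv, ih, map_list_prod, List.ofFn_succ, List.prod_cons, List.map_ofFn]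
    congr 3
    funext i
    apply WithConv.ofConv_injective
    ext x
    exact emb_slot (Fin.succEmb n) i x

theorem diag_one (x : H) : diag k H 1 x = slot k H 0 x := by
  have : diag k H 1 = slot k H 0 := conv_injective (by rw [conv_diag]; simp)
  rw [this]

theorem conv_comp_diag {A : Type*} [Ring A] [Algebra k A] {m : ℕ} (φ : Tens k H m →ₐ[k] A) :
    conv (φ.comp (diag k H m)) =
      (List.ofFn fun i : Fin m => conv (φ.comp (slot k H i))).prod := by
  rw [← convMap_conv, conv_diag, map_list_prod, List.map_ofFn]
  rfl

theorem prod_slot_perm [Coalgebra.IsCocomm k H] {n : ℕ} (l : List (Fin n))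
    (hl : l.Perm (List.finRange n)) :
    (l.map fun i => conv (slot k H i)).prod = conv (diag k H n) := by
  rw [conv_diag, List.ofFn_eq_map]
  refine (hl.map _).prod_eq' ?_
  rw [List.pairwise_map]
  refine (hl.nodup_iff.mpr (List.nodup_finRange n)).imp ?_
  intro i j hij
  exact conv_commute _ _ (fun x y => commute_slot hij x y)

theorem emb_diag [Coalgebra.IsCocomm k H] {n : ℕ} (σ : Equiv.Perm (Fin n)) :
    (emb k σ.toEmbedding).comp (diag k H n) = diag k H n := by
  apply conv_injective
  rw [conv_comp_diag, ← prod_slot_perm ((List.finRange n).map σ), List.ofFn_eq_map, List.map_map]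
  · congr 2
    funext i
    apply WithConv.ofConv_injective
    ext x
    exact emb_slot _ i x
  · exact (List.perm_ext_iff_of_nodup ((List.nodup_finRange n).map σ.injective)
      (List.nodup_finRange n)).mpr (fun i => by
        simpa using ⟨σ.symm i, by simp⟩)

variable (k) in
/-- For a bijection `e : Fin m ⊕ Fin p ≃ Fin n` and a position `s : Fin (p + 1)`, the algebra map
`H^{⊗ (p + 1)} → H^{⊗ n}` which applies the iterated coproduct `H → H^{⊗ m}` to the factor in
position `s`, puts the result in the positions `e (inl _)`, and puts the remaining factors, in
order, in the positions `e (inr _)`. -/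
noncomputable def split {m p n : ℕ} (s : Fin (p + 1)) (e : Fin m ⊕ Fin p ≃ Fin n) :
    Tens k H (p + 1) →ₐ[k] Tens k H n :=
  PiTensorProduct.liftAlgHom
    { toFun := fun h =>
        emb k (Function.Embedding.inl.trans e.toEmbedding) (diag k H m (h s)) *
          emb k (Function.Embedding.inr.trans e.toEmbedding)
            (PiTensorProduct.tprod k (s.removeNth h))
      map_update_add' := by
        intro inst h i x y
        cases Subsingleton.elim inst (instDecidableEqFin _)
        rcases Fin.eq_self_or_eq_succAbove s i with rfl | ⟨j, rfl⟩
        · simp [add_mul, Fin.removeNth_update]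
        · simp [Fin.removeNth_update_succAbove, mul_add]
      map_update_smul' := by
        intro inst h i c x
        cases Subsingleton.elim inst (instDecidableEqFin _)
        rcases Fin.eq_self_or_eq_succAbove s i with rfl | ⟨j, rfl⟩
        · simp [Fin.removeNth_update]
        · simp [Fin.removeNth_update_succAbove] }
    (by
      change emb k _ (diag k H m 1) * emb k _ 1 = 1
      simp)
    (by
      intro h h'
      change emb k _ (diag k H m (h s * h' s)) *
        emb k _ (PiTensorProduct.tprod k (s.removeNth h * s.removeNth h')) = _
      have hc := commute_tprod_extend (k := k)
        (Function.Embedding.inl.trans e.toEmbedding) (Function.Embedding.inr.trans e.toEmbedding)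
        (fun i j hh => by simpa using e.injective hh) (diag k H m (h' s))
        (PiTensorProduct.tprod k (s.removeNth h))
      rw [map_mul, map_mul, ← PiTensorProduct.tprod_mul_tprod, map_mul]
      exact hc.mul_mul_mul_comm _ _)

theorem split_tprod {m p n : ℕ} (s : Fin (p + 1)) (e : Fin m ⊕ Fin p ≃ Fin n)
    (h : Fin (p + 1) → H) :
    split k s e (PiTensorProduct.tprod k h) =
      emb k (Function.Embedding.inl.trans e.toEmbedding) (diag k H m (h s)) *
        emb k (Function.Embedding.inr.trans e.toEmbedding)
          (PiTensorProduct.tprod k (s.removeNth h)) := by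
  simp [split, PiTensorProduct.liftAlgHom]

theorem split_slot_self {m p n : ℕ} (s : Fin (p + 1)) (e : Fin m ⊕ Fin p ≃ Fin n) (x : H) :
    split k s e (slot k H s x) =
      emb k (Function.Embedding.inl.trans e.toEmbedding) (diag k H m x) := by
  rw [slot_apply, split_tprod, Fin.removeNth_update, Function.update_self]
  have : emb k (Function.Embedding.inr.trans e.toEmbedding)
      (PiTensorProduct.tprod k (s.removeNth (1 : Fin (p + 1) → H))) = 1 := map_one _
  rw [this, mul_one]

theorem split_slot_succAbove {m p n : ℕ} (s : Fin (p + 1)) (e : Fin m ⊕ Fin p ≃ Fin n)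
    (j : Fin p) (x : H) :
    split k s e (slot k H (s.succAbove j) x) = slot k H (e (Sum.inr j)) x := by
  rw [slot_apply, split_tprod, Fin.removeNth_update_succAbove,
    Function.update_of_ne (Fin.succAbove_ne s j).symm]
  have : (s.removeNth (1 : Fin (p + 1) → H)) = 1 := rfl
  rw [this, ← slot_apply, emb_slot, Pi.one_apply, map_one, map_one, one_mul]
  rfl

theorem split_diag [Coalgebra.IsCocomm k H] {m p n : ℕ} (s : Fin (p + 1))
    (e : Fin m ⊕ Fin p ≃ Fin n) :
    (split k s e).comp (diag k H (p + 1)) = diag k H n := by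
  apply conv_injective
  have h0 : conv (diag k H (p + 1)) =
      ((s :: (List.finRange p).map s.succAbove).map fun i => conv (slot k H i)).prod := by
    refine (prod_slot_perm _ ?_).symm
    refine (List.perm_ext_iff_of_nodup ?_ (List.nodup_finRange _)).mpr ?_
    · refine List.nodup_cons.mpr ⟨?_, (List.nodup_finRange p).map Fin.succAbove_right_injective⟩
      simp [Fin.succAbove_ne]
    · intro i
      rcases Fin.eq_self_or_eq_succAbove s i with rfl | ⟨j, rfl⟩ <;> simp
  have h1 : conv (diag k H n) = (((List.finRange m).map (fun i => e (Sum.inl i)) ++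
      (List.finRange p).map (fun i => e (Sum.inr i))).map fun i => conv (slot k H i)).prod := by
    refine (prod_slot_perm _ ?_).symm
    refine (List.perm_ext_iff_of_nodup ?_ (List.nodup_finRange _)).mpr ?_
    · refine List.Nodup.append ?_ ?_ ?_
      · exact (List.nodup_finRange m).map (e.injective.comp Sum.inl_injective)
      · exact (List.nodup_finRange p).map (e.injective.comp Sum.inr_injective)
      · intro a ha hb
        simp only [List.mem_map, List.mem_finRange, true_and] at ha hb
        obtain ⟨i, rfl⟩ := ha
        obtain ⟨j, hj⟩ := hb
        simpa using e.injective hj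
    · intro i
      obtain ⟨c, rfl⟩ := e.surjective i
      rcases c with c | c <;> simp
  rw [← convMap_conv, h0, h1, map_list_prod, List.map_map, List.map_cons, List.prod_cons,
    List.map_append, List.prod_append, List.map_map, List.map_map, List.map_map]
  congr 1
  · have : (convMap (split k s e)) (conv (slot k H s)) =
        convMap (emb k (Function.Embedding.inl.trans e.toEmbedding)) (conv (diag k H m)) := by
      apply WithConv.ofConv_injective
      ext x
      exact split_slot_self s e x
    rw [Function.comp_apply, this, conv_diag, map_list_prod, List.map_ofFn, List.ofFn_eq_map]
    congr 2
    funext i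
    apply WithConv.ofConv_injective
    ext x
    exact emb_slot _ i x
  · congr 2
    funext i
    apply WithConv.ofConv_injective
    ext x
    exact split_slot_succAbove s e i x

theorem emb_split {m p n : ℕ} (s : Fin (p + 1)) (e : Fin m ⊕ Fin p ≃ Fin n)
    (σ : Equiv.Perm (Fin n)) (t : Tens k H (p + 1)) :
    emb k σ.toEmbedding (split k s e t) = split k s (e.trans σ) t := by
  have : (emb k σ.toEmbedding).comp (split k s e) = split k (H := H) s (e.trans σ) := by
    refine PiTensorProduct.algHom_ext fun i => AlgHom.ext fun x => ?_
    change emb k _ (split k s e (slot k H i x)) = split k s (e.trans σ) (slot k H i x)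
    rcases Fin.eq_self_or_eq_succAbove s i with rfl | ⟨j, rfl⟩
    · rw [split_slot_self, split_slot_self]
      exact emb_emb _ _ _
    · rw [split_slot_succAbove, split_slot_succAbove, emb_slot]
      rfl
  exact DFunLike.congr_fun this t

end Tensors
section Pseudotensors
variable (k H : Type*) [Field k] [Ring H] [HopfAlgebra k H]

/-- The relations `(a · Δ⁽ⁿ⁾(h)) ⊗ m = a ⊗ h m` that are imposed in `H^{⊗ n} ⊗_H M`. -/
def balanced (n : ℕ) (M : Type*) [AddCommGroup M] [Module k M] [Module H M] :
    Submodule k (Tens k H n ⊗[k] M) :=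
  Submodule.span k {t | ∃ (a : Tens k H n) (h : H) (m : M),
    t = (a * diag k H n h) ⊗ₜ[k] m - a ⊗ₜ[k] (h • m)}

/-- The space `H^{⊗ n} ⊗_H M`, where `H` acts on `H^{⊗ n}` from the right through the iterated
coproduct. -/
def PT (n : ℕ) (M : Type*) [AddCommGroup M] [Module k M] [Module H M] : Type _ :=
  (Tens k H n ⊗[k] M) ⧸ balanced k H n M

noncomputable instance (n : ℕ) (M : Type*) [AddCommGroup M] [Module k M] [Module H M] :
    AddCommGroup (PT k H n M) :=
  inferInstanceAs (AddCommGroup ((Tens k H n ⊗[k] M) ⧸ balanced k H n M))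

noncomputable instance (n : ℕ) (M : Type*) [AddCommGroup M] [Module k M] [Module H M] :
    Module k (PT k H n M) :=
  inferInstanceAs (Module k ((Tens k H n ⊗[k] M) ⧸ balanced k H n M))

variable {k H}
variable {M N : Type*} [AddCommGroup M] [Module k M] [Module H M]
  [AddCommGroup N] [Module k N] [Module H N]

/-- The class `a ⊗_H m`. -/
def PT.mk {n : ℕ} (a : Tens k H n) (m : M) : PT k H n M :=
  Submodule.Quotient.mk (a ⊗ₜ[k] m)

theorem PT.mk_diag {n : ℕ} (a : Tens k H n) (h : H) (m : M) :
    PT.mk (k := k) (a * diag k H n h) m = PT.mk a (h • m) :=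
  (Submodule.Quotient.eq _).mpr (Submodule.subset_span ⟨a, h, m, rfl⟩)

theorem PT.mk_add {n : ℕ} (a : Tens k H n) (m m' : M) :
    PT.mk (k := k) a (m + m') = PT.mk a m + PT.mk a m' := by
  rw [PT.mk, TensorProduct.tmul_add]; rfl

theorem PT.mk_smul {n : ℕ} (a : Tens k H n) (c : k) (m : M) :
    PT.mk (k := k) a (c • m) = c • PT.mk a m := by
  rw [PT.mk, TensorProduct.tmul_smul]; rfl

theorem PT.induction {n : ℕ} {P : PT k H n M → Prop} (t : PT k H n M)
    (mk : ∀ a m, P (PT.mk a m)) (add : ∀ x y, P x → P y → P (x + y)) : P t := by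
  obtain ⟨t, rfl⟩ := Submodule.Quotient.mk_surjective _ t
  induction t with
  | zero => simpa [PT.mk] using mk 0 0
  | tmul a m => exact mk a m
  | add x y hx hy => exact add _ _ hx hy

theorem PT.hom_ext {n : ℕ} {V : Type*} [AddCommGroup V] [Module k V]
    {f g : PT k H n M →ₗ[k] V} (h : ∀ a m, f (PT.mk a m) = g (PT.mk a m)) : f = g :=
  LinearMap.ext fun t => PT.induction (P := fun t => f t = g t) t h
    (fun x y hx hy => by rw [map_add, map_add, hx, hy])

/-- The left action of `H^{⊗ n}` on `H^{⊗ n} ⊗_H M`. -/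
noncomputable def act {n : ℕ} (b : Tens k H n) : PT k H n M →ₗ[k] PT k H n M :=
  Submodule.mapQ _ _ ((LinearMap.mulLeft k b).rTensor M) (by
    rw [balanced, Submodule.span_le]
    rintro _ ⟨a, h, m, rfl⟩
    refine Submodule.subset_span ⟨b * a, h, m, ?_⟩
    simp [mul_assoc])

theorem act_mk {n : ℕ} (b a : Tens k H n) (m : M) :
    act b (PT.mk a m) = PT.mk (k := k) (b * a) m := rfl

/-- The map `φ ⊗_H id` for an algebra map `φ : H^{⊗ m} → H^{⊗ n}` that preserves the iterated
coproducts. -/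
noncomputable def push {m n : ℕ} (φ : Tens k H m →ₐ[k] Tens k H n)
    (hφ : φ.comp (diag k H m) = diag k H n) : PT k H m M →ₗ[k] PT k H n M :=
  Submodule.mapQ _ _ (φ.toLinearMap.rTensor M) (by
    rw [balanced, Submodule.span_le]
    rintro _ ⟨a, h, m, rfl⟩
    refine Submodule.subset_span ⟨φ a, h, m, ?_⟩
    have : φ (diag k H _ h) = diag k H n h := DFunLike.congr_fun hφ h
    simp [this])

theorem push_mk {m n : ℕ} (φ : Tens k H m →ₐ[k] Tens k H n)
    (hφ : φ.comp (diag k H m) = diag k H n) (a : Tens k H m) (x : M) :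
    push φ hφ (PT.mk a x) = PT.mk (k := k) (φ a) x := rfl

/-- The map `id ⊗_H D` for an `H`-linear map `D`. -/
noncomputable def mapPT [IsScalarTower k H M] [IsScalarTower k H N] {n : ℕ} (D : M →ₗ[H] N) :
    PT k H n M →ₗ[k] PT k H n N :=
  Submodule.mapQ _ _ ((D.restrictScalars k).lTensor (Tens k H n)) (by
    rw [balanced, Submodule.span_le]
    rintro _ ⟨a, h, m, rfl⟩
    refine Submodule.subset_span ⟨a, h, D m, ?_⟩
    simp)

theorem mapPT_mk [IsScalarTower k H M] [IsScalarTower k H N] {n : ℕ} (D : M →ₗ[H] N)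
    (a : Tens k H n) (m : M) :
    mapPT D (PT.mk a m) = PT.mk (k := k) a (D m) := rfl

theorem act_add {n : ℕ} (b b' : Tens k H n) (t : PT k H n M) :
    act (b + b') t = act b t + act b' t := by
  induction t using PT.induction with
  | mk a m => rw [act_mk, act_mk, act_mk, add_mul, PT.mk, TensorProduct.add_tmul]; rfl
  | add x y hx hy => rw [map_add, hx, hy, map_add, map_add]; abel

theorem act_smul {n : ℕ} (c : k) (b : Tens k H n) (t : PT k H n M) :
    act (c • b) t = c • act b t := by
  induction t using PT.induction with
  | mk a m => simp only [act_mk, smul_mul_assoc]; rfl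
  | add x y hx hy => rw [map_add, hx, hy, map_add, smul_add]

theorem act_act {n : ℕ} (b b' : Tens k H n) (t : PT k H n M) :
    act b (act b' t) = act (b * b') t := by
  induction t using PT.induction with
  | mk a m => simp only [act_mk, mul_assoc]
  | add x y hx hy => simp only [map_add, hx, hy]

theorem push_act {m n : ℕ} (φ : Tens k H m →ₐ[k] Tens k H n)
    (hφ : φ.comp (diag k H m) = diag k H n) (b : Tens k H m) (t : PT k H m M) :
    push φ hφ (act b t) = act (φ b) (push φ hφ t) := by
  induction t using PT.induction with
  | mk a x => simp only [act_mk, push_mk, map_mul]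
  | add x y hx hy => simp only [map_add, hx, hy]

theorem mapPT_act [IsScalarTower k H M] [IsScalarTower k H N] {n : ℕ} (D : M →ₗ[H] N)
    (b : Tens k H n) (t : PT k H n M) : mapPT D (act b t) = act b (mapPT D t) := by
  induction t using PT.induction with
  | mk a x => simp only [act_mk, mapPT_mk]
  | add x y hx hy => simp only [map_add, hx, hy]

theorem mapPT_push [IsScalarTower k H M] [IsScalarTower k H N] {m n : ℕ}
    (φ : Tens k H m →ₐ[k] Tens k H n) (hφ : φ.comp (diag k H m) = diag k H n) (D : M →ₗ[H] N)
    (t : PT k H m M) : mapPT D (push φ hφ t) = push φ hφ (mapPT D t) := by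
  induction t using PT.induction with
  | mk a x => simp only [push_mk, mapPT_mk]
  | add x y hx hy => simp only [map_add, hx, hy]

variable [Coalgebra.IsCocomm k H]

variable (k H) in
/-- The map `σ ⊗_H id` on `H^{⊗ n} ⊗_H M`, where `σ` moves the tensor factor in position `i` to
position `σ i`. -/
noncomputable def perm {n : ℕ} (σ : Equiv.Perm (Fin n)) : PT k H n M →ₗ[k] PT k H n M :=
  push (emb k σ.toEmbedding) (emb_diag σ)

theorem perm_mk {n : ℕ} (σ : Equiv.Perm (Fin n)) (a : Tens k H n) (m : M) :
    perm k H σ (PT.mk a m) = PT.mk (k := k) (emb k σ.toEmbedding a) m := rfl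

theorem perm_one {n : ℕ} (t : PT k H n M) : perm k H (1 : Equiv.Perm (Fin n)) t = t := by
  have h1 : emb k (1 : Equiv.Perm (Fin n)).toEmbedding = AlgHom.id k (Tens k H n) :=
    PiTensorProduct.algHom_ext fun i => AlgHom.ext fun x => emb_slot _ i x
  induction t using PT.induction with
  | mk a m => rw [perm_mk, h1]; rfl
  | add x y hx hy => rw [map_add, hx, hy]

theorem perm_perm {n : ℕ} (σ τ : Equiv.Perm (Fin n)) (t : PT k H n M) :
    perm k H σ (perm k H τ t) = perm k H (σ * τ) t := by
  have : (perm k H σ).comp (perm k H τ) = perm k H (M := M) (σ * τ) :=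
    PT.hom_ext fun a m => by
      simp only [LinearMap.comp_apply, perm_mk, emb_emb]
      rfl
  exact LinearMap.congr_fun this t

theorem perm_act {n : ℕ} (σ : Equiv.Perm (Fin n)) (b : Tens k H n) (t : PT k H n M) :
    perm k H σ (act b t) = act (emb k σ.toEmbedding b) (perm k H σ t) := push_act _ _ b t

theorem mapPT_perm [IsScalarTower k H M] [IsScalarTower k H N] {n : ℕ}
    (σ : Equiv.Perm (Fin n)) (D : M →ₗ[H] N) (t : PT k H n M) :
    mapPT D (perm k H σ t) = perm k H σ (mapPT D t) := mapPT_push _ _ D t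

end Pseudotensors

section Cochains
variable {k H : Type*} [Field k] [Ring H] [HopfAlgebra k H]
variable {A M : Type*} [AddCommGroup A] [Module k A] [Module H A]
  [AddCommGroup M] [Module k M] [Module H M]

/-- `H^{⊗ n}`-linearity of a `k`-multilinear map `A^n → H^{⊗ n} ⊗_H M`. -/
def IsPolylinear {n : ℕ} (f : MultilinearMap k (fun _ : Fin n => A) (PT k H n M)) : Prop :=
  ∀ (h : Fin n → H) (x : Fin n → A),
    f (fun i => h i • x i) = act (PiTensorProduct.tprod k h) (f x)

theorem IsPolylinear.smul_slot {n : ℕ} {f : MultilinearMap k (fun _ : Fin n => A) (PT k H n M)}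
    (hf : IsPolylinear f) (i : Fin n) (h : H) (x : Fin n → A) :
    f (Function.update x i (h • x i)) = act (slot k H i h) (f x) := by
  rw [slot_apply, ← hf]
  congr 1
  funext j
  by_cases hj : j = i
  · subst hj; simp
  · simp [Function.update_of_ne hj]

variable [Coalgebra.IsCocomm k H]

/-- Skew-symmetry of a map `A^n → H^{⊗ n} ⊗_H M`:
`f(x₁, …, xₙ) = (-1)^σ (σ ⊗_H id) f(x_{σ(1)}, …, x_{σ(n)})`. -/
def IsSkew {n : ℕ} (f : MultilinearMap k (fun _ : Fin n => A) (PT k H n M)) : Prop :=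
  ∀ (σ : Equiv.Perm (Fin n)) (x : Fin n → A),
    f x = ((Equiv.Perm.sign σ : ℤˣ) : ℤ) • perm k H σ (f (x ∘ σ))

variable (k H A M) in
/-- The space `C^n(A, M)` of skew-symmetric `H^{⊗ n}`-linear maps
`A^{⊗ n} → H^{⊗ n} ⊗_H M`. -/
def Cochain (n : ℕ) : Submodule k (MultilinearMap k (fun _ : Fin n => A) (PT k H n M)) where
  carrier := {f | IsPolylinear f ∧ IsSkew f}
  zero_mem' := ⟨fun h x => by simp, fun σ x => by simp⟩
  add_mem' := by
    rintro f g ⟨hf, hf'⟩ ⟨hg, hg'⟩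
    refine ⟨fun h x => ?_, fun σ x => ?_⟩
    · simp only [add_apply, map_add, hf h x, hg h x]
    · rw [add_apply, add_apply, map_add, smul_add, ← hf' σ x, ← hg' σ x]
  smul_mem' := by
    rintro c f ⟨hf, hf'⟩
    refine ⟨fun h x => ?_, fun σ x => ?_⟩
    · simp only [smul_apply, map_smul, hf h x]
    · rw [smul_apply, smul_apply, map_smul, smul_comm, ← hf' σ x]

noncomputable instance {n : ℕ} : CoeFun (Cochain k H A M n) (fun _ => (Fin n → A) → PT k H n M) :=
  ⟨fun f => f.1⟩

variable {B : Type*} [AddCommGroup B] [Module k B] [Module H B]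

/-- The `H`-polylinear extension of `f` in the argument with number `s`: for
`y = G ⊗_H a ∈ H^{⊗ m} ⊗_H B` and `f(…, a, …) = F ⊗_H c`, with the arguments `z` in the remaining
places, it is `(G ⊗ 1) (id ⊗ ⋯ ⊗ Δ⁽ᵐ⁾ ⊗ ⋯ ⊗ id)(F) ⊗_H c`, where the `m` tensor factors belonging to
`y` stand in the positions `e (inl _)` and those belonging to `z` in the positions `e (inr _)`. -/
noncomputable def extend {m p n : ℕ} (s : Fin (p + 1)) (e : Fin m ⊕ Fin p ≃ Fin n)
    (f : MultilinearMap k (fun _ : Fin (p + 1) => B) (PT k H (p + 1) M)) (hf : IsPolylinear f)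
    (z : Fin p → B) : PT k H m B →ₗ[k] PT k H n M :=
  Submodule.liftQ _ (TensorProduct.lift (LinearMap.mk₂ k
    (fun (a : Tens k H m) (b : B) => act (emb k (Function.Embedding.inl.trans e.toEmbedding) a)
      (push (split k s e) (split_diag s e) (f (s.insertNth (α := fun _ => B) b z))))
    (fun a a' b => by rw [map_add, act_add])
    (fun c a b => by rw [map_smul, act_smul])
    (fun a b b' => by rw [f.map_insertNth_add, map_add, map_add])
    (fun c a b => by rw [f.map_insertNth_smul, map_smul, map_smul]))) (by
    rw [balanced, Submodule.span_le]
    rintro _ ⟨a, h, b, rfl⟩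
    have h1 : f (s.insertNth (α := fun _ => B) (h • b) z) =
        act (slot k H s h) (f (s.insertNth (α := fun _ => B) b z)) := by
      rw [← hf.smul_slot]
      simp
    simp only [SetLike.mem_coe, LinearMap.mem_ker, map_sub, TensorProduct.lift.tmul,
      LinearMap.mk₂_apply]
    rw [h1, push_act, split_slot_self, act_act, map_mul, sub_self])

theorem extend_mk {m p n : ℕ} (s : Fin (p + 1)) (e : Fin m ⊕ Fin p ≃ Fin n)
    (f : MultilinearMap k (fun _ : Fin (p + 1) => B) (PT k H (p + 1) M)) (hf : IsPolylinear f)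
    (z : Fin p → B) (a : Tens k H m) (b : B) :
    extend s e f hf z (PT.mk a b) =
      act (emb k (Function.Embedding.inl.trans e.toEmbedding) a)
      (push (split k s e) (split_diag s e) (f (s.insertNth (α := fun _ => B) b z))) := rfl

theorem extend_act {m p n : ℕ} (s : Fin (p + 1)) (e : Fin m ⊕ Fin p ≃ Fin n)
    (f : MultilinearMap k (fun _ : Fin (p + 1) => B) (PT k H (p + 1) M)) (hf : IsPolylinear f)
    (z : Fin p → B) (a : Tens k H m) (t : PT k H m B) :
    extend s e f hf z (act a t) =
      act (emb k (Function.Embedding.inl.trans e.toEmbedding) a) (extend s e f hf z t) := by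
  induction t using PT.induction with
  | mk b x => rw [act_mk, extend_mk, extend_mk, act_act, map_mul]
  | add x y hx hy => simp only [map_add, hx, hy]

theorem push_congr {m n : ℕ} {φ ψ : Tens k H m →ₐ[k] Tens k H n} (h : φ = ψ)
    (hφ : φ.comp (diag k H m) = diag k H n) (hψ : ψ.comp (diag k H m) = diag k H n)
    (t : PT k H m M) : push φ hφ t = push ψ hψ t := by subst h; rfl

theorem perm_push {m n : ℕ} (σ : Equiv.Perm (Fin n)) (φ : Tens k H m →ₐ[k] Tens k H n)
    (hφ : φ.comp (diag k H m) = diag k H n) (t : PT k H m M) :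
    perm k H σ (push φ hφ t) = push ((emb k σ.toEmbedding).comp φ)
      (by rw [AlgHom.comp_assoc, hφ, emb_diag]) t := by
  induction t using PT.induction with
  | mk b x => rfl
  | add x y hx hy => simp only [map_add, hx, hy]

theorem perm_extend {m p n : ℕ} (s : Fin (p + 1)) (e : Fin m ⊕ Fin p ≃ Fin n)
    (f : MultilinearMap k (fun _ : Fin (p + 1) => B) (PT k H (p + 1) M)) (hf : IsPolylinear f)
    (z : Fin p → B) (σ : Equiv.Perm (Fin n)) (t : PT k H m B) :
    perm k H σ (extend s e f hf z t) = extend s (e.trans σ) f hf z t := by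
  induction t using PT.induction with
  | mk b x =>
    rw [extend_mk, extend_mk, perm_act, emb_emb, perm_push]
    congr 1
    exact push_congr (AlgHom.ext fun t => emb_split s e σ t) _ _ _
  | add x y hx hy => simp only [map_add, hx, hy]

theorem insertNth_update {p : ℕ} (s : Fin (p + 1)) (b : B) (z : Fin p → B) (i : Fin p) (c : B) :
    s.insertNth (α := fun _ => B) b (Function.update z i c) =
      Function.update (s.insertNth (α := fun _ => B) b z) (s.succAbove i) c := by
  funext j
  rcases Fin.eq_self_or_eq_succAbove s j with rfl | ⟨l, rfl⟩
  · rw [Function.update_of_ne (Fin.succAbove_ne _ i).symm]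
    simp
  · by_cases hl : l = i
    · subst hl; simp
    · rw [Function.update_of_ne (fun hh => hl (Fin.succAbove_right_injective hh))]
      simp [Function.update_of_ne hl]

theorem extend_update_add {m p n : ℕ} (s : Fin (p + 1)) (e : Fin m ⊕ Fin p ≃ Fin n)
    (f : MultilinearMap k (fun _ : Fin (p + 1) => B) (PT k H (p + 1) M)) (hf : IsPolylinear f)
    (z : Fin p → B) (i : Fin p) (c d : B) (t : PT k H m B) :
    extend s e f hf (Function.update z i (c + d)) t =
      extend s e f hf (Function.update z i c) t + extend s e f hf (Function.update z i d) t := by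
  induction t using PT.induction with
  | mk b x => simp only [extend_mk, insertNth_update, MultilinearMap.map_update_add, map_add]
  | add x y hx hy => rw [map_add, hx, hy, map_add, map_add]; abel

theorem extend_update_smul {m p n : ℕ} (s : Fin (p + 1)) (e : Fin m ⊕ Fin p ≃ Fin n)
    (f : MultilinearMap k (fun _ : Fin (p + 1) => B) (PT k H (p + 1) M)) (hf : IsPolylinear f)
    (z : Fin p → B) (i : Fin p) (r : k) (c : B) (t : PT k H m B) :
    extend s e f hf (Function.update z i (r • c)) t =
      r • extend s e f hf (Function.update z i c) t := by
  induction t using PT.induction with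
  | mk b x => simp only [extend_mk, insertNth_update, MultilinearMap.map_update_smul, map_smul]
  | add x y hx hy => rw [map_add, hx, hy, map_add, smul_add]

theorem extend_smul {m p n : ℕ} (s : Fin (p + 1)) (e : Fin m ⊕ Fin p ≃ Fin n)
    (f : MultilinearMap k (fun _ : Fin (p + 1) => B) (PT k H (p + 1) M)) (hf : IsPolylinear f)
    (z : Fin p → B) (h : Fin p → H) (t : PT k H m B) :
    extend s e f hf (fun i => h i • z i) t =
      act (emb k (Function.Embedding.inr.trans e.toEmbedding) (PiTensorProduct.tprod k h))
        (extend s e f hf z t) := by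
  induction t using PT.induction with
  | mk b x =>
    have h1 : s.insertNth (α := fun _ => B) x (fun i => h i • z i) =
        fun j => s.insertNth (α := fun _ => H) 1 h j • s.insertNth (α := fun _ => B) x z j := by
      funext j
      rcases Fin.eq_self_or_eq_succAbove s j with rfl | ⟨l, rfl⟩ <;> simp
    have hc := commute_tprod_extend (k := k)
        (Function.Embedding.inl.trans e.toEmbedding) (Function.Embedding.inr.trans e.toEmbedding)
        (fun i j hh => by simpa using e.injective hh) b (PiTensorProduct.tprod k h)
    rw [extend_mk, extend_mk, h1, hf, push_act, split_tprod, Fin.insertNth_apply_same, map_one,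
      map_one, one_mul, Fin.removeNth_insertNth, act_act, act_act, hc.eq]
  | add x y hx hy => rw [map_add, hx, hy, map_add, map_add]

theorem extend_perm_left {m p n : ℕ} (s : Fin (p + 1)) (e : Fin m ⊕ Fin p ≃ Fin n)
    (f : MultilinearMap k (fun _ : Fin (p + 1) => B) (PT k H (p + 1) M)) (hf : IsPolylinear f)
    (z : Fin p → B) (α : Equiv.Perm (Fin m)) (t : PT k H m B) :
    extend s e f hf z (perm k H α t) =
      extend s ((Equiv.sumCongr α (Equiv.refl _)).trans e) f hf z t := by
  induction t using PT.induction with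
  | mk b x =>
    rw [perm_mk, extend_mk, extend_mk, emb_emb]
    congr 1
    refine push_congr (PiTensorProduct.algHom_ext fun i => AlgHom.ext fun x => ?_) _ _ _
    change split k s e (slot k H i x) = split k s _ (slot k H i x)
    rcases Fin.eq_self_or_eq_succAbove s i with rfl | ⟨j, rfl⟩
    · rw [split_slot_self, split_slot_self]
      conv_lhs => rw [← emb_diag α]
      exact emb_emb _ _ _
    · rw [split_slot_succAbove, split_slot_succAbove]
      rfl
  | add x y hx hy => simp only [map_add, hx, hy]

theorem extend_perm_right {m p n : ℕ} (e : Fin m ⊕ Fin p ≃ Fin n)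
    (f : MultilinearMap k (fun _ : Fin (p + 1) => B) (PT k H (p + 1) M)) (hf : IsPolylinear f)
    (hf' : IsSkew f) (z : Fin p → B) (β : Equiv.Perm (Fin p)) (t : PT k H m B) :
    extend 0 e f hf z t = ((Equiv.Perm.sign β : ℤˣ) : ℤ) •
      extend 0 ((Equiv.sumCongr (Equiv.refl _) β).trans e) f hf (z ∘ β) t := by
  induction t using PT.induction with
  | mk b x =>
    have hs : Equiv.Perm.sign (Equiv.Perm.decomposeFin.symm (0, β)) = Equiv.Perm.sign β := by
      simp [Equiv.Perm.decomposeFin.symm_sign]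
    have h1 : (Fin.insertNth (α := fun _ => B) 0 x z) ∘ (Equiv.Perm.decomposeFin.symm (0, β)) =
        Fin.insertNth (α := fun _ => B) 0 x (z ∘ β) := by
      funext j
      refine Fin.cases ?_ (fun i => ?_) j <;> simp
    rw [extend_mk, extend_mk, hf' (Equiv.Perm.decomposeFin.symm (0, β)), hs, h1, map_zsmul,
      map_zsmul]
    congr 2
    generalize f (Fin.insertNth (α := fun _ => B) 0 x (z ∘ β)) = u
    induction u using PT.induction with
    | mk c y =>
      rw [perm_mk, push_mk, push_mk]
      congr 1
      have : (split k 0 e).comp (emb k (Equiv.Perm.decomposeFin.symm (0, β)).toEmbedding) =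
          split k (H := H) 0 ((Equiv.sumCongr (Equiv.refl _) β).trans e) := by
        refine PiTensorProduct.algHom_ext fun i => AlgHom.ext fun x => ?_
        change split k 0 e (emb k _ (slot k H i x)) = split k 0 _ (slot k H i x)
        rw [emb_slot]
        refine Fin.cases ?_ (fun i => ?_) i
        · have : (Equiv.Perm.decomposeFin.symm (0, β)).toEmbedding (0 : Fin (p + 1)) = 0 := by simp
          rw [this, split_slot_self, split_slot_self]
          rfl
        · have : (Equiv.Perm.decomposeFin.symm (0, β)).toEmbedding i.succ =
              Fin.succAbove 0 (β i) := by simp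
          have h2 : i.succ = Fin.succAbove 0 i := by simp
          rw [this, h2, split_slot_succAbove, split_slot_succAbove]
          rfl
      exact DFunLike.congr_fun this c
    | add x y hx hy => simp only [map_add, hx, hy]
  | add x y hx hy => rw [map_add, hx, hy, map_add, smul_add]

end Cochains

section Brackets
variable {k H : Type*} [Field k] [Ring H] [HopfAlgebra k H] [Coalgebra.IsCocomm k H]
variable {A M : Type*} [AddCommGroup A] [Module k A] [Module H A]
  [AddCommGroup M] [Module k M] [Module H M]

/-- The partial composition `f ∘ₛ g`, in which `g` is inserted in the argument of `f` with number
`s`; the arguments of `g` are the arguments of the composition with the numbers `e (inl _)`, and the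
remaining arguments of `f` are those with the numbers `e (inr _)`. -/
noncomputable def partialComp {m p n : ℕ} (s : Fin (p + 1)) (e : Fin m ⊕ Fin p ≃ Fin n)
    (f : Cochain k H A M (p + 1)) (g : Cochain k H A A m) :
    MultilinearMap k (fun _ : Fin n => A) (PT k H n M) where
  toFun x := extend s e f.1 f.2.1 (fun i => x (e (Sum.inr i))) (g fun i => x (e (Sum.inl i)))
  map_update_add' := by
    intro inst x i a b
    cases Subsingleton.elim inst (instDecidableEqFin _)
    have hl : ∀ (j : Fin m) (c : A), (fun i => Function.update x (e (Sum.inl j)) c (e (Sum.inl i))) =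
        Function.update (fun i => x (e (Sum.inl i))) j c := fun j c =>
      Function.update_comp_eq_of_injective x (e.injective.comp Sum.inl_injective) j c
    have hr : ∀ (j : Fin p) (c : A), (fun i => Function.update x (e (Sum.inr j)) c (e (Sum.inr i))) =
        Function.update (fun i => x (e (Sum.inr i))) j c := fun j c =>
      Function.update_comp_eq_of_injective x (e.injective.comp Sum.inr_injective) j c
    obtain ⟨j | j, rfl⟩ := e.surjective i
    · simp [hl, Function.update_of_ne]
    · simp [hr, extend_update_add, Function.update_of_ne]
  map_update_smul' := by
    intro inst x i r a
    cases Subsingleton.elim inst (instDecidableEqFin _)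
    have hl : ∀ (j : Fin m) (c : A), (fun i => Function.update x (e (Sum.inl j)) c (e (Sum.inl i))) =
        Function.update (fun i => x (e (Sum.inl i))) j c := fun j c =>
      Function.update_comp_eq_of_injective x (e.injective.comp Sum.inl_injective) j c
    have hr : ∀ (j : Fin p) (c : A), (fun i => Function.update x (e (Sum.inr j)) c (e (Sum.inr i))) =
        Function.update (fun i => x (e (Sum.inr i))) j c := fun j c =>
      Function.update_comp_eq_of_injective x (e.injective.comp Sum.inr_injective) j c
    obtain ⟨j | j, rfl⟩ := e.surjective i
    · simp [hl, Function.update_of_ne]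
    · simp [hr, extend_update_smul, Function.update_of_ne]

theorem partialComp_apply {m p n : ℕ} (s : Fin (p + 1)) (e : Fin m ⊕ Fin p ≃ Fin n)
    (f : Cochain k H A M (p + 1)) (g : Cochain k H A A m) (x : Fin n → A) :
    partialComp s e f g x =
      extend s e f.1 f.2.1 (fun i => x (e (Sum.inr i))) (g fun i => x (e (Sum.inl i))) := rfl

theorem partialComp_isPolylinear {m p n : ℕ} (s : Fin (p + 1)) (e : Fin m ⊕ Fin p ≃ Fin n)
    (f : Cochain k H A M (p + 1)) (g : Cochain k H A A m) :
    IsPolylinear (partialComp s e f g) := by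
  intro h x
  rw [partialComp_apply, partialComp_apply,
    g.2.1 (fun i => h (e (Sum.inl i))) (fun i => x (e (Sum.inl i))), extend_act,
    extend_smul s e f.1 f.2.1 (fun i => x (e (Sum.inr i))) (fun i => h (e (Sum.inr i))), act_act]
  congr 2
  rw [emb_tprod, emb_tprod, PiTensorProduct.tprod_mul_tprod]
  congr 1
  funext j
  obtain ⟨j | j, rfl⟩ := e.surjective j
  · have h1 : e (Sum.inl j) = (Function.Embedding.inl.trans e.toEmbedding) j := rfl
    rw [Pi.mul_apply]
    conv_lhs => rw [h1]
    rw [Function.Injective.extend_apply (Function.Embedding.injective _),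
      Function.extend_apply' _ _ _ (fun ⟨i, hi⟩ => by simpa using e.injective hi)]
    simp
  · have h1 : e (Sum.inr j) = (Function.Embedding.inr.trans e.toEmbedding) j := rfl
    rw [Pi.mul_apply]
    conv_lhs => rw [h1]
    rw [Function.Injective.extend_apply (Function.Embedding.injective _),
      Function.extend_apply' _ _ _ (fun ⟨i, hi⟩ => by simpa using e.injective hi)]
    simp

theorem partialComp_block {m p n : ℕ} (e : Fin m ⊕ Fin p ≃ Fin n)
    (f : Cochain k H A M (p + 1)) (g : Cochain k H A A m) (α : Equiv.Perm (Fin m))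
    (β : Equiv.Perm (Fin p)) (x : Fin n → A) :
    partialComp 0 e f g x =
      (((Equiv.Perm.sign α : ℤˣ) : ℤ) * ((Equiv.Perm.sign β : ℤˣ) : ℤ)) •
        partialComp 0 ((Equiv.sumCongr α β).trans e) f g x := by
  rw [partialComp_apply, g.2.2 α, map_zsmul, extend_perm_left,
    extend_perm_right _ f.1 f.2.1 f.2.2 _ β, smul_smul]
  rfl

theorem perm_partialComp {m p n : ℕ} (s : Fin (p + 1)) (e : Fin m ⊕ Fin p ≃ Fin n)
    (f : Cochain k H A M (p + 1)) (g : Cochain k H A A m) (σ : Equiv.Perm (Fin n))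
    (x : Fin n → A) :
    perm k H σ (partialComp s e f g (x ∘ σ)) = partialComp s (e.trans σ) f g x :=
  perm_extend _ _ _ f.2.1 _ _ _

/-- The bijection `Fin m ⊕ Fin p ≃ Fin n` which sends `Fin m` to the first `m` and `Fin p` to the
last `p` indices, where `m + p = n`. -/
def blocks {m p n : ℕ} (h : m + p = n) : Fin m ⊕ Fin p ≃ Fin n :=
  finSumFinEquiv.trans (finCongr h)

/-- The `(m, p)`-shuffles, `m + p = n`: the permutations of `n` indices that are increasing on the
first `m` and on the last `p` indices. -/
def shuffles {m p n : ℕ} (h : m + p = n) : Finset (Equiv.Perm (Fin n)) :=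
  Finset.univ.filter fun σ =>
    (∀ i j : Fin m, i < j → σ (blocks h (Sum.inl i)) < σ (blocks h (Sum.inl j))) ∧
    (∀ i j : Fin p, i < j → σ (blocks h (Sum.inr i)) < σ (blocks h (Sum.inr j)))

/-- The permutation which permutes the first `m` indices by `α` and the last `p` by `β`. -/
def blockPerm {m p n : ℕ} (h : m + p = n) (α : Equiv.Perm (Fin m)) (β : Equiv.Perm (Fin p)) :
    Equiv.Perm (Fin n) :=
  ((blocks h).symm.trans (Equiv.sumCongr α β)).trans (blocks h)

/-- The shuffle that differs from `σ` by a permutation within the blocks. -/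
def toShuffle {m p n : ℕ} (h : m + p = n) (σ : Equiv.Perm (Fin n)) : Equiv.Perm (Fin n) :=
  σ * blockPerm h (Tuple.sort fun i => σ (blocks h (Sum.inl i)))
    (Tuple.sort fun i => σ (blocks h (Sum.inr i)))

theorem blockPerm_mul {m p n : ℕ} (h : m + p = n) (α α' : Equiv.Perm (Fin m))
    (β β' : Equiv.Perm (Fin p)) :
    blockPerm h α β * blockPerm h α' β' = blockPerm h (α * α') (β * β') := by
  ext i
  obtain ⟨i | i, rfl⟩ := (blocks h).surjective i <;> simp [blockPerm]

theorem toShuffle_mem {m p n : ℕ} (h : m + p = n) (σ : Equiv.Perm (Fin n)) :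
    toShuffle h σ ∈ shuffles h := by
  simp only [shuffles, Finset.mem_filter, Finset.mem_univ, true_and]
  constructor
  · have hm := (Tuple.monotone_sort fun i => σ (blocks h (Sum.inl i))).strictMono_of_injective
      ((σ.injective.comp ((blocks h).injective.comp Sum.inl_injective)).comp
        (Equiv.injective _))
    intro i j hij
    simpa [toShuffle, blockPerm] using hm hij
  · have hm := (Tuple.monotone_sort fun i => σ (blocks h (Sum.inr i))).strictMono_of_injective
      ((σ.injective.comp ((blocks h).injective.comp Sum.inr_injective)).comp
        (Equiv.injective _))
    intro i j hij
    simpa [toShuffle, blockPerm] using hm hij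

theorem eq_one_of_monotone {m n : ℕ} (u : Fin m → Fin n) (hu : Function.Injective u)
    (α : Equiv.Perm (Fin m)) (h1 : ∀ i j, i < j → u i < u j)
    (h2 : ∀ i j, i < j → u (α i) < u (α j)) : α = 1 := by
  have := Tuple.unique_monotone (f := u) (σ := 1) (τ := α)
    (StrictMono.monotone (fun i j hij => h1 i j hij))
    (StrictMono.monotone (fun i j hij => h2 i j hij))
  ext i
  exact congrArg Fin.val (hu (congrFun this i)).symm

theorem toShuffle_mul_blockPerm {m p n : ℕ} (h : m + p = n) (σ : Equiv.Perm (Fin n))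
    (hσ : σ ∈ shuffles h) (α : Equiv.Perm (Fin m)) (β : Equiv.Perm (Fin p)) :
    toShuffle h (σ * blockPerm h α β) = σ := by
  have hm := toShuffle_mem h (σ * blockPerm h α β)
  rw [toShuffle, mul_assoc, blockPerm_mul] at hm ⊢
  generalize α * _ = α' at hm ⊢
  generalize β * _ = β' at hm ⊢
  simp only [shuffles, Finset.mem_filter, Finset.mem_univ, true_and] at hm hσ
  have hα : α' = 1 := eq_one_of_monotone (fun i => σ (blocks h (Sum.inl i)))
    (σ.injective.comp ((blocks h).injective.comp Sum.inl_injective)) α' hσ.1 (fun i j hij => by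
      simpa [blockPerm] using hm.1 i j hij)
  have hβ : β' = 1 := eq_one_of_monotone (fun i => σ (blocks h (Sum.inr i)))
    (σ.injective.comp ((blocks h).injective.comp Sum.inr_injective)) β' hσ.2 (fun i j hij => by
      simpa [blockPerm] using hm.2 i j hij)
  subst hα hβ
  ext i
  obtain ⟨i | i, rfl⟩ := (blocks h).surjective i <;> simp [blockPerm]

theorem sum_shuffles {V : Type*} [AddCommMonoid V] {m p n : ℕ} (h : m + p = n)
    (F : Equiv.Perm (Fin n) → V) (hF : ∀ σ α β, F (σ * blockPerm h α β) = F σ)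
    (τ : Equiv.Perm (Fin n)) :
    ∑ σ ∈ shuffles h, F (τ * σ) = ∑ σ ∈ shuffles h, F σ := by
  refine Finset.sum_bij' (fun σ _ => toShuffle h (τ * σ)) (fun σ _ => toShuffle h (τ⁻¹ * σ))
    (fun σ _ => toShuffle_mem h _) (fun σ _ => toShuffle_mem h _) ?_ ?_ ?_
  · intro σ hσ
    rw [toShuffle.eq_1 h (τ * σ), mul_assoc, inv_mul_cancel_left, toShuffle_mul_blockPerm h σ hσ]
  · intro σ hσ
    rw [toShuffle.eq_1 h (τ⁻¹ * σ), mul_assoc, mul_inv_cancel_left,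
      toShuffle_mul_blockPerm h σ hσ]
  · intro σ _
    rw [toShuffle, hF]

/-- The circle product
`(f ⊚ g)(x₁, …, xₙ) = ∑_σ (-1)^σ (σ ⊗_H id) f(g(x_{σ(1)}, …, x_{σ(m)}), x_{σ(m+1)}, …, x_{σ(n)})`,
the sum being over the `(m, p)`-shuffles, `n = m + p`. -/
noncomputable def circ {m p n : ℕ} (h : m + p = n) (f : Cochain k H A M (p + 1))
    (g : Cochain k H A A m) : Cochain k H A M n :=
  ⟨∑ σ ∈ shuffles h, ((Equiv.Perm.sign σ : ℤˣ) : ℤ) •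
      (perm k H σ).compMultilinearMap ((partialComp 0 (blocks h) f g).domDomCongr σ), by
    have key : ∀ x : Fin n → A, (∑ σ ∈ shuffles h, ((Equiv.Perm.sign σ : ℤˣ) : ℤ) •
        (perm k H σ).compMultilinearMap ((partialComp 0 (blocks h) f g).domDomCongr σ)) x =
        ∑ σ ∈ shuffles h, ((Equiv.Perm.sign σ : ℤˣ) : ℤ) •
          partialComp 0 ((blocks h).trans σ) f g x := by
      intro x
      rw [sum_apply]
      refine Finset.sum_congr rfl fun σ _ => ?_
      rw [← perm_partialComp]
      rfl
    refine ⟨fun r x => ?_, fun τ x => ?_⟩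
    · rw [key, key, map_sum]
      refine Finset.sum_congr rfl fun σ _ => ?_
      rw [partialComp_isPolylinear, map_zsmul]
    · rw [key, key, map_sum, Finset.smul_sum]
      have hF : ∀ (σ : Equiv.Perm (Fin n)) (α : Equiv.Perm (Fin m)) (β : Equiv.Perm (Fin p)),
          ((Equiv.Perm.sign (σ * blockPerm h α β) : ℤˣ) : ℤ) •
            partialComp 0 ((blocks h).trans (σ * blockPerm h α β)) f g x =
          ((Equiv.Perm.sign σ : ℤˣ) : ℤ) • partialComp 0 ((blocks h).trans σ) f g x := by
        intro σ α β
        have h1 : (blocks h).trans (σ * blockPerm h α β) =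
            (Equiv.sumCongr α β).trans ((blocks h).trans σ) := by
          ext i
          simp [blockPerm]
        have h2 : Equiv.Perm.sign (blockPerm h α β) =
            Equiv.Perm.sign α * Equiv.Perm.sign β := by
          rw [blockPerm, Equiv.Perm.sign_symm_trans_trans]
          exact Equiv.Perm.sign_sumCongr α β
        rw [h1, partialComp_block ((blocks h).trans σ) f g α β x, smul_smul, map_mul, h2,
          Units.val_mul, Units.val_mul]
      rw [← sum_shuffles h _ hF τ]
      refine Finset.sum_congr rfl fun σ _ => ?_
      have h3 : (blocks h).trans (τ * σ) = ((blocks h).trans σ).trans τ := rfl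
      rw [map_zsmul, perm_partialComp, smul_smul, h3, map_mul, Units.val_mul]⟩

/-- The Nijenhuis-Richardson bracket `[f, g] = f ⊚ g - (-1)^{pq} g ⊚ f` of cochains of degrees `p`
and `q`; a cochain of degree `p` has `p + 1` arguments. -/
noncomputable def nrBracket {p q r : ℕ} (h : p + q = r) (f : Cochain k H A A (p + 1))
    (g : Cochain k H A A (q + 1)) : Cochain k H A A (r + 1) :=
  circ (by omega : (q + 1) + p = r + 1) f g -
    (-1 : ℤ) ^ (p * q) • circ (by omega : (p + 1) + q = r + 1) g f

/-- The bijection that puts the one argument of the second block first. -/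
def lastFirst : Fin 2 ⊕ Fin 1 ≃ Fin 3 :=
  (Equiv.sumComm (Fin 2) (Fin 1)).trans (blocks (by norm_num))

/-- The Jacobi identity
`[x₁ * [x₂ * x₃]] - [[x₁ * x₂] * x₃] - ((12) ⊗_H id) [x₂ * [x₁ * x₃]] = 0`
for a skew-symmetric pseudobracket. -/
def IsLieBracket (b : Cochain k H A A 2) : Prop :=
  ∀ x : Fin 3 → A,
    partialComp 1 lastFirst b b x - partialComp 0 (blocks (by norm_num)) b b x -
      perm k H (Equiv.swap 0 1) (partialComp 1 lastFirst b b (x ∘ Equiv.swap 0 1)) = 0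

/-- The cochain `(id ⊗_H j) ∘ f ∘ (q ⊗ ⋯ ⊗ q)` for `H`-linear maps `q` and `j`. -/
noncomputable def transport {B N : Type*} [AddCommGroup B] [Module k B] [Module H B]
    [AddCommGroup N] [Module k N] [Module H N] [IsScalarTower k H A] [IsScalarTower k H B]
    [IsScalarTower k H M] [IsScalarTower k H N] {n : ℕ}
    (j : M →ₗ[H] N) (q : B →ₗ[H] A) (f : Cochain k H A M n) : Cochain k H B N n :=
  ⟨(mapPT j).compMultilinearMap (f.1.compLinearMap fun _ => q.restrictScalars k), by
    refine ⟨fun h x => ?_, fun σ x => ?_⟩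
    · change mapPT j (f fun i => q (h i • x i)) = act _ (mapPT j (f fun i => q (x i)))
      rw [← mapPT_act, ← f.2.1]
      simp
    · change mapPT j (f fun i => q (x i)) = _ • perm k H σ (mapPT j (f fun i => q (x (σ i))))
      rw [f.2.2 σ, map_zsmul, mapPT_perm]
      rfl⟩

theorem transport_apply {B N : Type*} [AddCommGroup B] [Module k B] [Module H B]
    [AddCommGroup N] [Module k N] [Module H N] [IsScalarTower k H A] [IsScalarTower k H B]
    [IsScalarTower k H M] [IsScalarTower k H N] {n : ℕ}
    (j : M →ₗ[H] N) (q : B →ₗ[H] A) (f : Cochain k H A M n) (x : Fin n → B) :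
    transport j q f x = mapPT j (f fun i => q (x i)) := rfl

end Brackets
theorem update_zero {X : Type*} (a b c : X) : Function.update ![a, b] 0 c = ![c, b] := by
  funext i
  fin_cases i <;> rfl

theorem update_one {X : Type*} (a b c : X) : Function.update ![a, b] 1 c = ![a, c] := by
  funext i
  fin_cases i <;> rfl

section QuasiTwilled
variable (k H : Type*) [Field k] [Ring H] [HopfAlgebra k H] [Coalgebra.IsCocomm k H]
variable (g h : Type*) [AddCommGroup g] [Module k g] [Module H g] [IsScalarTower k H g]
  [AddCommGroup h] [Module k h] [Module H h] [IsScalarTower k H h]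

/-- A quasi-twilled Lie pseudoalgebra `(g ⊞ h, g, h)`: a Lie pseudoalgebra structure on the direct
sum of two left `H`-modules for which `h` is a subpseudoalgebra, that is, the pseudobracket of two
elements of `h` has no component in `H^{⊗ 2} ⊗_H g`. -/
structure QuasiTwilled where
  /-- the pseudobracket, a skew-symmetric `H^{⊗ 2}`-linear map -/
  bracket : Cochain k H (g × h) (g × h) 2
  jacobi : IsLieBracket bracket
  closed : ∀ u v : h, mapPT (LinearMap.fst H g h) (bracket ![(0, u), (0, v)]) = 0

variable {k H g h}

/-- A `k`-bilinear map `g × h → H^{⊗ 2} ⊗_H M` is `H^{⊗ 2}`-linear. -/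
def IsPolylinear₂ {M : Type*} [AddCommGroup M] [Module k M] [Module H M]
    (κ : g →ₗ[k] h →ₗ[k] PT k H 2 M) : Prop :=
  ∀ (a b : H) (x : g) (u : h), κ (a • x) (b • u) = act (PiTensorProduct.tprod k ![a, b]) (κ x u)

/-- The lift of an `H^{⊗ 2}`-linear map `κ : g ⊗ h → H^{⊗ 2} ⊗_H M` to a cochain on `g ⊞ h`:
`((x, u), (y, v)) ↦ κ(x, v) - ((12) ⊗_H id) κ(y, u)`. -/
noncomputable def mixedLift {M : Type*} [AddCommGroup M] [Module k M] [Module H M]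
    (κ : g →ₗ[k] h →ₗ[k] PT k H 2 M) (hκ : IsPolylinear₂ κ) : Cochain k H (g × h) M 2 :=
  ⟨{ toFun := fun X => κ (X 0).1 (X 1).2 - perm k H (Equiv.swap 0 1) (κ (X 1).1 (X 0).2)
     map_update_add' := by
       intro inst X i a b
       cases Subsingleton.elim inst (instDecidableEqFin _)
       fin_cases i <;> simp <;> abel
     map_update_smul' := by
       intro inst X i c a
       cases Subsingleton.elim inst (instDecidableEqFin _)
       fin_cases i <;> simp [smul_sub] }, by
    refine ⟨fun r X => ?_, fun σ X => ?_⟩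
    · change κ (r 0 • (X 0).1) (r 1 • (X 1).2) -
        perm k H (Equiv.swap 0 1) (κ (r 1 • (X 1).1) (r 0 • (X 0).2)) = act _
        (κ (X 0).1 (X 1).2 - perm k H (Equiv.swap 0 1) (κ (X 1).1 (X 0).2))
      rw [hκ, hκ, map_sub, perm_act, emb_tprod]
      have h1 : ![r 0, r 1] = r := by ext i; fin_cases i <;> rfl
      have h2 : Function.extend (Equiv.swap (0 : Fin 2) 1).toEmbedding ![r 1, r 0] 1 = r := by
        funext i
        have : i = (Equiv.swap (0 : Fin 2) 1).toEmbedding (Equiv.swap 0 1 i) := by simp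
        rw [this, Function.Injective.extend_apply (Function.Embedding.injective _)]
        fin_cases i <;> simp
      rw [h1, h2]
    · change κ (X 0).1 (X 1).2 - perm k H (Equiv.swap 0 1) (κ (X 1).1 (X 0).2) =
        _ • perm k H σ (κ (X (σ 0)).1 (X (σ 1)).2 -
          perm k H (Equiv.swap 0 1) (κ (X (σ 1)).1 (X (σ 0)).2))
      have hσ : σ = 1 ∨ σ = Equiv.swap 0 1 := by revert σ; decide
      have hsw : (Equiv.swap (0 : Fin 2) 1) * Equiv.swap 0 1 = 1 := Equiv.swap_mul_self _ _
      rcases hσ with rfl | rfl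
      · simp [perm_one]
      · rw [map_sub, perm_perm, hsw, perm_one]
        simp⟩

namespace QuasiTwilled
variable (Q : QuasiTwilled k H g h)

/-- The component `π : g ⊗ g → H^{⊗ 2} ⊗_H g` of the pseudobracket. -/
noncomputable def π : Cochain k H g g 2 :=
  transport (LinearMap.fst H g h) (LinearMap.inl H g h) Q.bracket

/-- The component `θ : g ⊗ g → H^{⊗ 2} ⊗_H h` of the pseudobracket. -/
noncomputable def θ : Cochain k H g h 2 :=
  transport (LinearMap.snd H g h) (LinearMap.inl H g h) Q.bracket

/-- The component `μ : h ⊗ h → H^{⊗ 2} ⊗_H h` of the pseudobracket. -/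
noncomputable def μ : Cochain k H h h 2 :=
  transport (LinearMap.snd H g h) (LinearMap.inr H g h) Q.bracket

/-- The pseudobracket of an element of `g` with an element of `h`. -/
noncomputable def mixed : g →ₗ[k] h →ₗ[k] PT k H 2 (g × h) :=
  LinearMap.mk₂ k (fun x u => Q.bracket ![(x, 0), (0, u)])
    (fun x y u => by
      have := Q.bracket.1.map_update_add ![0, ((0 : g), u)] 0 (x, 0) (y, 0)
      rwa [update_zero, update_zero, update_zero, Prod.mk_add_mk, add_zero] at this)
    (fun c x u => by
      have := Q.bracket.1.map_update_smul ![0, ((0 : g), u)] 0 c (x, 0)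
      rwa [update_zero, update_zero, Prod.smul_mk, smul_zero] at this)
    (fun x u v => by
      have := Q.bracket.1.map_update_add ![(x, (0 : h)), 0] 1 (0, u) (0, v)
      rwa [update_one, update_one, update_one, Prod.mk_add_mk, add_zero] at this)
    (fun c x u => by
      have := Q.bracket.1.map_update_smul ![(x, (0 : h)), 0] 1 c (0, u)
      rwa [update_one, update_one, Prod.smul_mk, smul_zero] at this)

/-- The component `η : g ⊗ h → H^{⊗ 2} ⊗_H g` of the pseudobracket. -/
noncomputable def η : g →ₗ[k] h →ₗ[k] PT k H 2 g :=
  Q.mixed.compr₂ (mapPT (LinearMap.fst H g h))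

/-- The component `ρ : g ⊗ h → H^{⊗ 2} ⊗_H h` of the pseudobracket. -/
noncomputable def ρ : g →ₗ[k] h →ₗ[k] PT k H 2 h :=
  Q.mixed.compr₂ (mapPT (LinearMap.snd H g h))

theorem mixed_isPolylinear : IsPolylinear₂ Q.mixed := by
  intro a b x u
  change Q.bracket _ = act _ (Q.bracket _)
  rw [← Q.bracket.2.1]
  congr 1
  funext i
  fin_cases i <;> simp

theorem η_isPolylinear : IsPolylinear₂ Q.η := fun a b x u => by
  change mapPT _ (Q.mixed _ _) = act _ (mapPT _ (Q.mixed _ _))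
  rw [Q.mixed_isPolylinear, mapPT_act]

theorem ρ_isPolylinear : IsPolylinear₂ Q.ρ := fun a b x u => by
  change mapPT _ (Q.mixed _ _) = act _ (mapPT _ (Q.mixed _ _))
  rw [Q.mixed_isPolylinear, mapPT_act]

/-- The lift of `π` to a cochain on `g ⊞ h`. -/
noncomputable def πLift : Cochain k H (g × h) (g × h) 2 :=
  transport (LinearMap.inl H g h) (LinearMap.fst H g h) Q.π

/-- The lift of `μ` to a cochain on `g ⊞ h`. -/
noncomputable def μLift : Cochain k H (g × h) (g × h) 2 :=
  transport (LinearMap.inr H g h) (LinearMap.snd H g h) Q.μ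

/-- The lift of `η` to a cochain on `g ⊞ h`. -/
noncomputable def ηLift : Cochain k H (g × h) (g × h) 2 :=
  transport (LinearMap.inl H g h) LinearMap.id (mixedLift Q.η Q.η_isPolylinear)

/-- The lift of `ρ` to a cochain on `g ⊞ h`. -/
noncomputable def ρLift : Cochain k H (g × h) (g × h) 2 :=
  transport (LinearMap.inr H g h) LinearMap.id (mixedLift Q.ρ Q.ρ_isPolylinear)

/-- A deformation map of type I: an `H`-linear map `D : g → h` with
`D(π(x, y) + η(x, D y) - (12) η(y, D x)) = μ(D x, D y) + ρ(x, D y) - (12) ρ(y, D x) + θ(x, y)`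
in `H^{⊗ 2} ⊗_H h`, where `D` on the left stands for `id ⊗_H D` and `(12)` for `(12) ⊗_H id`. -/
def IsDeformationMapI (D : g →ₗ[H] h) : Prop :=
  ∀ x y : g,
    mapPT D (Q.π ![x, y] + Q.η x (D y) - perm k H (Equiv.swap 0 1) (Q.η y (D x))) =
      Q.μ ![D x, D y] + Q.ρ x (D y) - perm k H (Equiv.swap 0 1) (Q.ρ y (D x)) + Q.θ ![x, y]

end QuasiTwilled

variable (k) in
/-- An `H`-linear map `D : g → h` as an element of `C¹(g, h)`, `x ↦ 1 ⊗_H D x`. -/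
noncomputable def ofHom (D : g →ₗ[H] h) : Cochain k H g h 1 :=
  ⟨{ toFun := fun x => PT.mk 1 (D (x 0))
     map_update_add' := by
       intro inst X i a b
       cases Subsingleton.elim inst (instDecidableEqFin _)
       cases Subsingleton.elim i 0
       simp [PT.mk_add]
     map_update_smul' := by
       intro inst X i c a
       cases Subsingleton.elim inst (instDecidableEqFin _)
       cases Subsingleton.elim i 0
       simp [PT.mk_smul, LinearMap.map_smul_of_tower] }, by
    refine ⟨fun r x => ?_, fun σ x => ?_⟩
    · change PT.mk 1 (D (r 0 • x 0)) = act _ (PT.mk 1 (D (x 0)))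
      rw [map_smul, ← PT.mk_diag, act_mk, mul_one, one_mul, diag_one, slot_apply]
      congr 2
      funext i
      cases Subsingleton.elim i 0
      simp
    · cases Subsingleton.elim σ 1
      change PT.mk 1 (D (x 0)) = _ • perm k H 1 (PT.mk 1 (D (x 0)))
      rw [perm_one]
      simp⟩

/-- The inclusion `C^n(g, h) → C^n(g ⊞ h, g ⊞ h)`. -/
noncomputable def inclusion {n : ℕ} (f : Cochain k H g h n) : Cochain k H (g × h) (g × h) n :=
  transport (LinearMap.inr H g h) (LinearMap.fst H g h) f

/-- The projection `P : C^n(g ⊞ h, g ⊞ h) → C^n(g, h)` onto the component with all arguments in `g`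
and values in `h`. -/
noncomputable def projection {n : ℕ} (F : Cochain k H (g × h) (g × h) n) : Cochain k H g h n :=
  transport (LinearMap.snd H g h) (LinearMap.inl H g h) F

namespace QuasiTwilled
variable (Q : QuasiTwilled k H g h)

/-- The operation `l₁(f) = [π + ρ, f]_NR` on `⨁ₙ C^{n+1}(g, h)`. -/
noncomputable def l₁ {p : ℕ} (f : Cochain k H g h (p + 1)) : Cochain k H g h (p + 1 + 1) :=
  projection (nrBracket (add_comm 1 p) (Q.πLift + Q.ρLift) (inclusion f))

/-- The operation `l₂(f, f') = [[μ + η, f]_NR, f']_NR` on `⨁ₙ C^{n+1}(g, h)`. -/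
noncomputable def l₂ {p q r : ℕ} (hr : p + q + 1 = r) (f : Cochain k H g h (p + 1))
    (f' : Cochain k H g h (q + 1)) : Cochain k H g h (r + 1) :=
  projection (nrBracket (by omega : (p + 1) + q = r)
    (nrBracket (add_comm 1 p) (Q.μLift + Q.ηLift) (inclusion f)) (inclusion f'))

/-- The twisted operation `l₁^D(f) = l₁(f) + l₂(D, f)`. -/
noncomputable def twistedL₁ (D : g →ₗ[H] h) {p : ℕ} (f : Cochain k H g h (p + 1)) :
    Cochain k H g h (p + 1 + 1) :=
  Q.l₁ f + Q.l₂ (by omega : 0 + p + 1 = p + 1) (ofHom k D) f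

/-- The twisted operation `l₂^D(f, f') = l₂(f, f')`. -/
noncomputable def twistedL₂ (_D : g →ₗ[H] h) {p q r : ℕ} (hr : p + q + 1 = r)
    (f : Cochain k H g h (p + 1)) (f' : Cochain k H g h (q + 1)) : Cochain k H g h (r + 1) :=
  Q.l₂ hr f f'

end QuasiTwilled
end QuasiTwilled
end Pseudo

namespace Pseudo
-- Brackets of a 2-cochain with a linear map, evaluated on pairs
section Evaluation
variable {k H : Type*} [Field k] [Ring H] [HopfAlgebra k H]
variable {A M N : Type*} [AddCommGroup A] [Module k A] [Module H A]
  [AddCommGroup M] [Module k M] [Module H M] [AddCommGroup N] [Module k N] [Module H N]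

/-! The deformation equation is a quadratic equation in the linear map. Move its left side to the
right and call the difference Δ(D), a map of pairs (x, y) into H^{⊗2} ⊗_H h. Its constant part is
θ(x, y). Its linear part is ρ(x, Dy) - (12) ρ(y, Dx) - D π(x, y). Its quadratic part is μ(Dx, Dy) -
D(η(x, Dy) - (12) η(y, Dx)).

The linear part is l₁(D), and the quadratic part is ½ l₂(D, D), where l₂ on linear maps is the
symmetric polarization. Hence Δ(D) = θ + l₁(D) + ½ l₂(D, D), and expanding a sum gives Δ(D + D') =
Δ(D) + l₁(D') + l₂(D, D') + ½ l₂(D', D'). The last three terms are l₁^D(D') + ½ l₂^D(D', D'). Since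
Δ(D) = 0, the left side vanishes exactly when D' is Maurer–Cartan for the twisted operations.

The work lies in computing the two operations from Nijenhuis–Richardson brackets. Viewed on the
direct sum, D is the endomorphism φ(x, u) = (0, Dx). The bracket of a 2-cochain f with a linear map
φ is [f, φ](X, Y) = f(φX, Y) - (12) f(φY, X) - φ f(X, Y), which is `nrBracket_two_one`. It applies
once to π + ρ, giving `l₁_ofHom_apply`. It applies twice to μ + η, giving `nrBracket_μη_ofHom_apply`
and then `l₂_ofHom_apply`. What remains is a linear identity, checked for each pair (x, y). -/

theorem emb_eq_self {n : ℕ} (e : Fin n ↪ Fin n) (he : ∀ i, e i = i) (t : Tens k H n) :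
    emb k e t = t := by
  have : emb k e = AlgHom.id k (Tens k H n) :=
    PiTensorProduct.algHom_ext fun i => AlgHom.ext fun x => by
      change emb k e (slot k H i x) = slot k H i x
      rw [emb_slot, he]
  exact DFunLike.congr_fun this t

/-- The one-fold coproduct is the identity of H, so inserting a single argument in the first place,
with the order of the factors kept, changes nothing. This removes coproducts when a 1-cochain is
inserted into another cochain. Both sides are algebra maps, so it suffices to compare them on
elements placed in a single tensor factor. -/
theorem split_one_eq_self {n : ℕ} (e : Fin 1 ⊕ Fin n ≃ Fin (n + 1)) (h0 : e (Sum.inl 0) = 0)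
    (h1 : ∀ i, e (Sum.inr i) = i.succ) (t : Tens k H (n + 1)) : split k 0 e t = t := by
  have : split k 0 e = AlgHom.id k (Tens k H (n + 1)) :=
    PiTensorProduct.algHom_ext fun i => AlgHom.ext fun x => by
      change split k 0 e (slot k H i x) = slot k H i x
      refine Fin.cases ?_ (fun j => ?_) i
      · rw [split_slot_self, diag_one, emb_slot]
        exact congrArg (fun l => slot k H l x) h0
      · rw [← Fin.succAbove_zero_apply, split_slot_succAbove, h1, Fin.succAbove_zero_apply]
  exact DFunLike.congr_fun this t

theorem act_one {n : ℕ} (t : PT k H n M) : act (1 : Tens k H n) t = t := by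
  induction t using PT.induction with
  | mk a m => rw [act_mk, one_mul]
  | add x y hx hy => rw [map_add, hx, hy]

theorem push_eq_self {n : ℕ} (φ : Tens k H n →ₐ[k] Tens k H n)
    (hφ : φ.comp (diag k H n) = diag k H n) (h : ∀ t, φ t = t) (t : PT k H n M) :
    push φ hφ t = t := by
  induction t using PT.induction with
  | mk a m => rw [push_mk, h]
  | add x y hx hy => rw [map_add, hx, hy]

/-! ### Functoriality and additivity of id ⊗_H D in D -/

theorem mapPT_add_apply [IsScalarTower k H M] [IsScalarTower k H N] {n : ℕ} (D E : M →ₗ[H] N)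
    (t : PT k H n M) : mapPT (D + E) t = mapPT D t + mapPT E t := by
  induction t using PT.induction with
  | mk a m => rw [mapPT_mk, LinearMap.add_apply, PT.mk_add]; rfl
  | add x y hx hy => rw [map_add, hx, hy, map_add, map_add]; abel

theorem mapPT_comp_apply {P : Type*} [AddCommGroup P] [Module k P] [Module H P]
    [IsScalarTower k H M] [IsScalarTower k H N] [IsScalarTower k H P] {n : ℕ}
    (E : N →ₗ[H] P) (D : M →ₗ[H] N) (t : PT k H n M) :
    mapPT (E ∘ₗ D) t = mapPT E (mapPT D t) := by
  induction t using PT.induction with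
  | mk a m => rfl
  | add x y hx hy => rw [map_add, hx, hy, map_add, map_add]

theorem mapPT_id_apply [IsScalarTower k H M] {n : ℕ} (t : PT k H n M) :
    mapPT (LinearMap.id : M →ₗ[H] M) t = t := by
  induction t using PT.induction with
  | mk a m => rfl
  | add x y hx hy => rw [map_add, hx, hy]

theorem mapPT_zero_apply [IsScalarTower k H M] [IsScalarTower k H N] {n : ℕ} (t : PT k H n M) :
    mapPT (0 : M →ₗ[H] N) t = 0 := by
  -- Since 0 + 0 = 0, additivity gives z = z + z for the value z, hence z = 0.
  have h := mapPT_add_apply (0 : M →ₗ[H] N) 0 t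
  rwa [add_zero, left_eq_add] at h

theorem mapPT_snd_inl [IsScalarTower k H M] [IsScalarTower k H N] {n : ℕ}
    (t : PT k H n M) :
    mapPT (LinearMap.snd H M N) (mapPT (LinearMap.inl H M N) t) = 0 := by
  rw [← mapPT_comp_apply, LinearMap.snd_comp_inl, mapPT_zero_apply]

theorem mapPT_snd_inr [IsScalarTower k H M] [IsScalarTower k H N] {n : ℕ}
    (t : PT k H n N) :
    mapPT (LinearMap.snd H M N) (mapPT (LinearMap.inr H M N) t) = t := by
  rw [← mapPT_comp_apply, LinearMap.snd_comp_inr, mapPT_id_apply]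

theorem mapPT_fst_inl [IsScalarTower k H M] [IsScalarTower k H N] {n : ℕ}
    (t : PT k H n M) :
    mapPT (LinearMap.fst H M N) (mapPT (LinearMap.inl H M N) t) = t := by
  rw [← mapPT_comp_apply, LinearMap.fst_comp_inl, mapPT_id_apply]

theorem mapPT_fst_inr [IsScalarTower k H M] [IsScalarTower k H N] {n : ℕ}
    (t : PT k H n N) :
    mapPT (LinearMap.fst H M N) (mapPT (LinearMap.inr H M N) t) = 0 := by
  rw [← mapPT_comp_apply, LinearMap.fst_comp_inr, mapPT_zero_apply]

variable [Coalgebra.IsCocomm k H]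

/-! ### The transposition, and circle products in arities one and two -/

theorem perm_swap_perm_swap (t : PT k H 2 M) :
    perm k H (Equiv.swap 0 1) (perm k H (Equiv.swap 0 1) t) = t := by
  rw [perm_perm, Equiv.swap_mul_self, perm_one]

theorem Cochain.apply_swap (f : Cochain k H A M 2) (x y : A) :
    perm k H (Equiv.swap 0 1) (f ![x, y]) = -f ![y, x] := by
  have h := f.2.2 (Equiv.swap 0 1) ![y, x]
  have h2 : ![y, x] ∘ Equiv.swap (0 : Fin 2) 1 = ![x, y] := by
    funext i; fin_cases i <;> simp
  rw [Equiv.Perm.sign_swap (by decide), h2] at h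
  rw [h]
  simp

theorem Cochain.add_apply' {n : ℕ} (f f' : Cochain k H A M n) (x : Fin n → A) :
    (f + f') x = f x + f' x := rfl

theorem circ_apply {m p n : ℕ} (h : m + p = n) (f : Cochain k H A M (p + 1))
    (d : Cochain k H A A m) (x : Fin n → A) :
    circ h f d x = ∑ σ ∈ shuffles h, ((Equiv.Perm.sign σ : ℤˣ) : ℤ) •
      perm k H σ (partialComp 0 (blocks h) f d (x ∘ σ)) := by
  change (∑ σ ∈ shuffles h, ((Equiv.Perm.sign σ : ℤˣ) : ℤ) •
      (perm k H σ).compMultilinearMap ((partialComp 0 (blocks h) f d).domDomCongr σ)) x = _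
  rw [sum_apply]
  rfl

/-- The circle product of a `2`-cochain with the `1`-cochain of a linear map `φ`. -/
theorem circ_two_one (h : 1 + 1 = 2) (f : Cochain k H A M 2) (d : Cochain k H A A 1)
    (φ : A → A) (hd : ∀ x, d x = PT.mk 1 (φ (x 0))) (x y : A) :
    circ h f d ![x, y] = f ![φ x, y] - perm k H (Equiv.swap 0 1) (f ![φ y, x]) := by
  -- Blocks of length one impose no monotonicity condition, so every permutation of two indices is a
  -- (1, 1)-shuffle. The transposition is odd and contributes the minus sign.
  have hsh : shuffles h = {1, Equiv.swap 0 1} := by decide +revert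
  have key : ∀ z : Fin 2 → A, partialComp 0 (blocks h) f d z = f ![φ (z 0), z 1] := by
    intro z
    -- The inserted value is 1 ⊗_H φ(z₀). Its coefficient 1 acts trivially, and the map that splits
    -- the first factor is the identity.
    rw [partialComp_apply, hd, extend_mk, map_one, act_one, push_eq_self]
    · congr 1
      funext i
      fin_cases i <;> rfl
    · exact split_one_eq_self _ rfl (fun i => by fin_cases i; rfl)
  rw [circ_apply, hsh, Finset.sum_pair (by decide), key, key]
  simp [perm_one, sub_eq_add_neg]

/-- The circle product of the `1`-cochain of an `H`-linear map `φ` with a `2`-cochain. -/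
theorem circ_one_two [IsScalarTower k H A] (h : 2 + 0 = 2) (f : Cochain k H A A 2)
    (d : Cochain k H A A 1) (φ : A →ₗ[H] A) (hd : ∀ x, d x = PT.mk 1 (φ (x 0))) (x : Fin 2 → A) :
    circ h d f x = mapPT φ (f x) := by
  -- With an empty second block, a shuffle is increasing on all indices, hence trivial.
  have hsh : shuffles h = {1} := by decide +revert
  rw [circ_apply, hsh, Finset.sum_singleton, perm_one, partialComp_apply]
  have hx : (fun i => (x ∘ (1 : Equiv.Perm (Fin 2))) (blocks h (Sum.inl i))) = x := rfl
  rw [hx]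
  -- Both sides are additive in the pseudotensor f(x), so it may be taken of the form a ⊗_H b.
  generalize f x = t
  simp only [Equiv.Perm.sign_one, Units.val_one, one_smul]
  induction t using PT.induction with
  | mk a b =>
    have hd' := hd (Fin.insertNth (α := fun _ => A) 0 b
      (fun i => (x ∘ (1 : Equiv.Perm (Fin 2))) (blocks h (Sum.inr i))))
    rw [extend_mk]
    erw [hd']
    -- Since d(b) = 1 ⊗_H φ(b), the coproduct is applied only to 1. The coefficient a is left
    -- untouched and the result is a ⊗_H φ(b).
    rw [push_mk, map_one, act_mk, mul_one, emb_eq_self _ (fun i => rfl), mapPT_mk]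
    rfl
  | add s t hs ht => rw [map_add, hs, ht, map_add]

/-- The bracket of a `2`-cochain with the `1`-cochain of an `H`-linear map `φ`. -/
theorem nrBracket_two_one [IsScalarTower k H A] (h : 1 + 0 = 1) (f : Cochain k H A A 2)
    (d : Cochain k H A A 1) (φ : A →ₗ[H] A) (hd : ∀ x, d x = PT.mk 1 (φ (x 0))) (x y : A) :
    (nrBracket h f d : Cochain k H A A 2) ![x, y] =
      f ![φ x, y] - perm k H (Equiv.swap 0 1) (f ![φ y, x]) - mapPT φ (f ![x, y]) := by
  rw [← circ_two_one (by norm_num) f d φ hd, ← circ_one_two (by norm_num) f d φ hd]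
  -- The cochains have degrees 1 and 0, so the sign (-1)^{pq} is 1.
  simp only [nrBracket, mul_zero, pow_zero, one_smul]
  rfl

end Evaluation

/-! ### The operations l₁ and l₂ on linear maps g → h -/

section QuasiTwilled
variable {k H : Type*} [Field k] [Ring H] [HopfAlgebra k H] [Coalgebra.IsCocomm k H]
variable {g h : Type*} [AddCommGroup g] [Module k g] [Module H g] [IsScalarTower k H g]
  [AddCommGroup h] [Module k h] [Module H h] [IsScalarTower k H h]

/-- Extending D by zero gives the 1-cochain of the endomorphism (x, u) ↦ (0, Dx), which is the form
that `nrBracket_two_one` requires. -/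
theorem inclusion_ofHom (D : g →ₗ[H] h) (X : Fin 1 → g × h) :
    inclusion (ofHom k D) X =
      PT.mk 1 (((LinearMap.inr H g h).comp (D.comp (LinearMap.fst H g h))) (X 0)) := rfl

theorem projection_apply {n : ℕ} (F : Cochain k H (g × h) (g × h) n) (x : Fin n → g) :
    projection F x = mapPT (LinearMap.snd H g h) (F fun i => (x i, 0)) := rfl

theorem pair_comp {X Y : Type*} (u : X → Y) (x y : X) :
    (fun i : Fin 2 => u (![x, y] i)) = ![u x, u y] := by
  funext i; fin_cases i <;> rfl

theorem transport_pair {A B M N : Type*} [AddCommGroup A] [Module k A] [Module H A]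
    [AddCommGroup M] [Module k M] [Module H M] [AddCommGroup B] [Module k B] [Module H B]
    [AddCommGroup N] [Module k N] [Module H N] [IsScalarTower k H A] [IsScalarTower k H B]
    [IsScalarTower k H M] [IsScalarTower k H N]
    (j : M →ₗ[H] N) (q : B →ₗ[H] A) (f : Cochain k H A M 2) (x y : B) :
    transport j q f ![x, y] = mapPT j (f ![q x, q y]) := by
  rw [transport_apply, pair_comp]

theorem Cochain.apply_zero_left {A M : Type*} [AddCommGroup A] [Module k A] [Module H A]
    [AddCommGroup M] [Module k M] [Module H M] (f : Cochain k H A M 2) (y : A) :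
    f ![0, y] = 0 := f.1.map_coord_zero 0 rfl

theorem Cochain.apply_zero_right {A M : Type*} [AddCommGroup A] [Module k A] [Module H A]
    [AddCommGroup M] [Module k M] [Module H M] (f : Cochain k H A M 2) (x : A) :
    f ![x, 0] = 0 := f.1.map_coord_zero 1 rfl

theorem Cochain.apply_add_add {A M : Type*} [AddCommGroup A] [Module k A] [Module H A]
    [AddCommGroup M] [Module k M] [Module H M] (f : Cochain k H A M 2) (x x' y y' : A) :
    f ![x + x', y + y'] = f ![x, y] + f ![x, y'] + f ![x', y] + f ![x', y'] := by
  have h0 : ∀ z, f ![x + x', z] = f ![x, z] + f ![x', z] := fun z => by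
    have := f.1.map_update_add ![0, z] 0 x x'
    rwa [update_zero, update_zero, update_zero] at this
  have h1 : ∀ z, f ![z, y + y'] = f ![z, y] + f ![z, y'] := fun z => by
    have := f.1.map_update_add ![z, 0] 1 y y'
    rwa [update_one, update_one, update_one] at this
  rw [h0, h1, h1]
  abel

namespace QuasiTwilled
variable (Q : QuasiTwilled k H g h)

theorem πLift_add_ρLift_apply (X Y : g × h) :
    (Q.πLift + Q.ρLift) ![X, Y] = mapPT (LinearMap.inl H g h) (Q.π ![X.1, Y.1]) +
      mapPT (LinearMap.inr H g h)
        (Q.ρ X.1 Y.2 - perm k H (Equiv.swap 0 1) (Q.ρ Y.1 X.2)) := by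
  rw [Cochain.add_apply', πLift, ρLift, transport_pair, transport_pair]
  rfl

theorem μLift_add_ηLift_apply (X Y : g × h) :
    (Q.μLift + Q.ηLift) ![X, Y] = mapPT (LinearMap.inr H g h) (Q.μ ![X.2, Y.2]) +
      mapPT (LinearMap.inl H g h)
        (Q.η X.1 Y.2 - perm k H (Equiv.swap 0 1) (Q.η Y.1 X.2)) := by
  rw [Cochain.add_apply', μLift, ηLift, transport_pair, transport_pair]
  rfl

/-- This is the linear part of the deformation equation, right side minus left. With φ(x, u) = (0,
Dx), inserting φ into one argument kills π and leaves only ρ. Applying φ to the value leaves only D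
π(x, y). -/
theorem l₁_ofHom_apply (D : g →ₗ[H] h) (x y : g) :
    (Q.l₁ (p := 0) (ofHom k D) : Cochain k H g h 2) ![x, y] =
      Q.ρ x (D y) - perm k H (Equiv.swap 0 1) (Q.ρ y (D x)) - mapPT D (Q.π ![x, y]) := by
  have h0 := nrBracket_two_one (add_comm 1 0) (Q.πLift + Q.ρLift) (inclusion (ofHom k D)) _
    (inclusion_ofHom D) (x, 0) (y, 0)
  change mapPT _ ((nrBracket (add_comm 1 0) (Q.πLift + Q.ρLift) (inclusion (ofHom k D)) :
    Cochain k H (g × h) (g × h) 2) (fun i => (![x, y] i, 0))) = _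
  rw [pair_comp (fun z : g => (z, (0 : h))), h0]
  -- The term ρ(x, Dy) comes from the transposed shuffle: its (12) cancels the (12) in the
  -- skew-symmetric extension of ρ, and the two minus signs cancel as well.
  simp only [πLift_add_ρLift_apply, LinearMap.comp_apply, LinearMap.fst_apply, LinearMap.inr_apply, map_add, map_sub,
    map_zero, Cochain.apply_zero_left, mapPT_perm, mapPT_comp_apply,
    mapPT_snd_inr, mapPT_fst_inl, perm_swap_perm_swap]
  abel

/-- The cochain `[μ + η, D]` of an `H`-linear map `D`. -/
theorem nrBracket_μη_ofHom_apply (D : g →ₗ[H] h) (X Y : g × h) :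
    (nrBracket (add_comm 1 0) (Q.μLift + Q.ηLift) (inclusion (ofHom k D)) :
        Cochain k H (g × h) (g × h) 2) ![X, Y] =
      mapPT (LinearMap.inr H g h) (Q.μ ![D X.1, Y.2] + Q.μ ![X.2, D Y.1] -
        mapPT D (Q.η X.1 Y.2 - perm k H (Equiv.swap 0 1) (Q.η Y.1 X.2))) +
      mapPT (LinearMap.inl H g h)
        (Q.η X.1 (D Y.1) - perm k H (Equiv.swap 0 1) (Q.η Y.1 (D X.1))) := by
  rw [nrBracket_two_one (add_comm 1 0) (Q.μLift + Q.ηLift) (inclusion (ofHom k D)) _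
    (inclusion_ofHom D)]
  -- Skew-symmetry of μ turns -(12) μ(D Y.1, X.2) into μ(X.2, D Y.1). The outer application of D
  -- sees only the g-component of the value, that is, the η-terms. General X and Y are kept because
  -- the next bracket inserts elements of h.
  simp only [μLift_add_ηLift_apply, LinearMap.comp_apply, LinearMap.fst_apply, LinearMap.inr_apply, map_add, map_sub,
    map_zero, map_neg, LinearMap.zero_apply, Cochain.apply_swap, ← mapPT_perm, mapPT_comp_apply,
    mapPT_fst_inl, mapPT_fst_inr, perm_swap_perm_swap]
  abel

/-- Let F be the bracket of μ + η with D. Inserting E into one argument of F gives the μ-terms and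
the terms where D is outermost. Applying E to the value of F, whose g-component on g ⊗ g is η(x, Dy)
- (12) η(y, Dx), gives the terms where E is outermost. The result is symmetric in D and E, and for E
= D it is twice the quadratic part of the deformation equation. -/
theorem l₂_ofHom_apply (D E : g →ₗ[H] h) (x y : g) :
    (Q.l₂ (p := 0) (q := 0) (r := 1) (by norm_num) (ofHom k D) (ofHom k E) :
        Cochain k H g h 2) ![x, y] =
      Q.μ ![D x, E y] + Q.μ ![E x, D y] -
        mapPT D (Q.η x (E y) - perm k H (Equiv.swap 0 1) (Q.η y (E x))) -
        mapPT E (Q.η x (D y) - perm k H (Equiv.swap 0 1) (Q.η y (D x))) := by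
  have hF := Q.nrBracket_μη_ofHom_apply D
  have hP : (Q.l₂ (p := 0) (q := 0) (r := 1) (by norm_num) (ofHom k D) (ofHom k E) :
      Cochain k H g h 2) = projection (n := 2) (nrBracket (p := 1) (q := 0) (r := 1) (add_comm 1 0)
        (nrBracket (p := 1) (q := 0) (r := 1) (add_comm 1 0) (Q.μLift + Q.ηLift)
          (inclusion (ofHom k D))) (inclusion (ofHom k E))) := rfl
  rw [hP, projection_apply, pair_comp (fun z : g => (z, (0 : h)))]
  -- Only the values of the inner bracket on pairs matter from here on, and these are recorded in
  -- `hF`.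
  generalize (nrBracket (p := 1) (q := 0) (r := 1) (add_comm 1 0) (Q.μLift + Q.ηLift)
          (inclusion (ofHom k D))) = F at hF ⊢
  rw [nrBracket_two_one (add_comm 1 0) F (inclusion (ofHom k E)) _ (inclusion_ofHom E)]
  have hF' : ∀ X Y, F ![X, Y] = _ := hF
  simp only [hF', LinearMap.comp_apply, LinearMap.fst_apply, LinearMap.inr_apply, map_add, map_sub,
    map_zero, LinearMap.zero_apply, Cochain.apply_swap, mapPT_perm, mapPT_comp_apply,
    Cochain.apply_zero_left, Cochain.apply_zero_right,
    mapPT_snd_inr, mapPT_fst_inl, perm_swap_perm_swap]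
  abel

end QuasiTwilled
end QuasiTwilled
end Pseudo

/-! ### The equivalence for D + D' -/

theorem theorem3 {k H g h : Type*} [Field k] [CharZero k] [Ring H] [HopfAlgebra k H]
    [Coalgebra.IsCocomm k H]
    [AddCommGroup g] [Module k g] [Module H g] [IsScalarTower k H g]
    [AddCommGroup h] [Module k h] [Module H h] [IsScalarTower k H h]
    (Q : Pseudo.QuasiTwilled k H g h) (D : g →ₗ[H] h) (hD : Q.IsDeformationMapI D)
    (D' : g →ₗ[H] h) :
    Q.IsDeformationMapI (D + D') ↔
      Q.twistedL₁ D (Pseudo.ofHom k D') + (2⁻¹ : k) •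
        Q.twistedL₂ D (by norm_num : 0 + 0 + 1 = 1) (Pseudo.ofHom k D') (Pseudo.ofHom k D') =
          0 := by
  set L := Q.twistedL₁ D (Pseudo.ofHom k D') + (2⁻¹ : k) •
    Q.twistedL₂ D (by norm_num : 0 + 0 + 1 = 1) (Pseudo.ofHom k D') (Pseudo.ofHom k D') with hL
  have hz : L = 0 ↔ ∀ x y : g, L ![x, y] = 0 := by
    refine ⟨fun h0 x y => by rw [h0]; rfl, fun h0 => Subtype.ext (MultilinearMap.ext fun x => ?_)⟩
    have hx : x = ![x 0, x 1] := by funext i; fin_cases i <;> rfl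
    rw [hx]
    exact h0 _ _
  rw [hz]
  -- The deformation equation and the Maurer–Cartan equation are equivalent separately for each pair
  -- (x, y), since the defect of D already vanishes at each pair.
  refine forall_congr' fun x => forall_congr' fun y => ?_
  have hv : L ![x, y] = (Q.l₁ (p := 0) (Pseudo.ofHom k D') : Pseudo.Cochain k H g h 2) ![x, y] +
      (Q.l₂ (p := 0) (q := 0) (r := 1) (by norm_num) (Pseudo.ofHom k D) (Pseudo.ofHom k D') :
        Pseudo.Cochain k H g h 2) ![x, y] + (2⁻¹ : k) •
      (Q.l₂ (p := 0) (q := 0) (r := 1) (by norm_num) (Pseudo.ofHom k D') (Pseudo.ofHom k D') :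
        Pseudo.Cochain k H g h 2) ![x, y] := rfl
  have hxy := hD x y
  rw [hv, Q.l₁_ofHom_apply, Q.l₂_ofHom_apply, Q.l₂_ofHom_apply]
  -- Everything is expanded in D and D': the maps id ⊗_H D, ρ and η by additivity, and μ(Dx + D'x,
  -- Dy + D'y) into four terms.
  simp only [LinearMap.add_apply, map_add, map_sub, Pseudo.mapPT_add_apply,
    Pseudo.Cochain.apply_add_add] at hxy ⊢
  constructor
  · intro h1
    -- The identity behind both directions is Δ(D + D') = Δ(D) + L, with Δ the right side minus the
    -- left side of the deformation equation and L the Maurer–Cartan expression, all at (x, y).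
    -- Exchanging goal and hypothesis leaves the coefficients the same. The terms of l₂(D', D')
    -- occur in equal pairs, which the factor 2⁻¹ merges into one.
    linear_combination (norm := module) hxy - h1
  · intro h1
    linear_combination (norm := module) hxy - h1
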